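/- Let $p$ be a prime and let $G$ be a locally compact abelian group whose topology is generated by a chain of open subgroups $\cdots\supset G_{-1}\supset G_0\supset G_1\supset\cdots$ with $\bigcup_n G_n=G$, $\bigcap_n G_n=\{0\}$ and $|G_n/G_{n+1}|=p$ for all $n\in\mathbb Z$. Fix $g_n\in G_n\setminus G_{n+1}$; every $x\in G$ is uniquely $x=\sum_n a_ng_n$ with $a_n\in\{0,\dots,p-1\}$ and $a_n=0$ for all sufficiently negative $n$. Assume that the bijection $\mathcal A:\sum a_ng_n\mapsto\sum a_ng_{n-1}$ of $G$ is additive (for instance $G=\mathbb Q_p$, $g_n=p^n$, $\mathcal Ax=x/p$). Let $X$ be the group of continuous unitary characters of $G$, let $(\chi,x)$ be the value of $\chi\in X$ at $x$, put $(\chi\mathcal A^k,x)=(\chi,\mathcal A^kx)$ for $k\in\mathbb Z$ and $G_n^\perp=\{\chi\in X:\chi|_{G_n}=1\}$, and fix $r_n\in G_{n+1}^\perp\setminus G_n^\perp$ for every $n\in\mathbb Z$. Let $\mu$ and $\nu$ be the Haar measures on $G$ and $X$ with $\mu(G_0)=\nu(G_0^\perp)=1$, and $\hat f(\chi)=\int_G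 f\,\overline{(\chi,\cdot)}\,d\mu$. Let $H_0$ be the set of all finite sums $a_{-1}g_{-1}+\dots+a_{-s}g_{-s}$ with digits $a_k\in\{0,\dots,p-1\}$. Let $M,N\ge 0$ be integers and let $\varphi:G\to\mathbb C$ be supported on $G_{-N}$ and constant on the cosets of $G_M$. Suppose that $\varphi$ is refinable with mask $m_0$, i.e. $\varphi(x)=p\sum_{h\in H_0}\beta_h\varphi(\mathcal Ax-h)$ for some $(\beta_h)\in\ell^2(H_0)$, and $m_0(\chi)=\sum_{h\in H_0}\beta_h\overline{(\chi\mathcal A^{-1},h)}$ (with convergence in $L_2(G_n^\perp)$ for every $n$). Let $m_1,\dots,m_q:X\to\mathbb C$ be functions (masks) such that 1. $\hat\varphi(\chi\mathcal A^{-1})\,m_j(\chi)=\mathbf 1_{E_j}(\chi)$ for all $\chi\in X$ and $j=1,\dots,q$, where $E_j=G_{-s(j)}^\perp\, r_{-s(j)}^{\alpha_{-s(j)}}r_{-s(j)+1}^{\alpha_{-s(j)+1}}\cdots r_M^{\alpha_M}$ with an integer $s(j)\ge 0$ and digits $\alpha_k=\alpha_k^{(j)}\in\{0,\dots,p-1\}$;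 the cosets $E_1,\dots,E_q$ are pairwise disjoint, and for every $t\in\mathbb Z$ so are the sets $E_1\mathcal A^t,\dots,E_q\mathcal A^t$; 2. there are integers $t(j)\ge0$ such that the sets $E_j\mathcal A^{t(j)}$ are pairwise disjoint and $\bigsqcup_{j=1}^q E_j\mathcal A^{t(j)}=G_{M+1}^\perp\setminus G_M^\perp$. Let $\psi^{(j)}$ be the function with $\hat\psi^{(j)}(\chi)=\hat\varphi(\chi\mathcal A^{-1})m_j(\chi)$, i.e. $\psi^{(j)}(x)=\int_X\hat\varphi(\chi\mathcal A^{-1})m_j(\chi)(\chi,x)\,d\nu(\chi)$. Then the functions $\psi^{(j)}_{n,h}(x)=p^{n/2}\psi^{(j)}(\mathcal A^nx-h)$, $1\le j\le q$, $n\in\mathbb Z$, $h\in H_0$, belong to $L_2(G)$ and form a Parseval (tight) wavelet frame of $L_2(G)$: for every $f\in L_2(G)$, $$\sum_{j,n,h}|\langle f,\psi^{(j)}_{n,h}\rangle|^2=\|f\|^2\quad\text{and}\quad \sum_{j,n,h}\langle f,\psi^{(j)}_{n,h}\rangle\,\psi^{(j)}_{n,h}=f .$$ -/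

import Mathlib

open MeasureTheory Filter Topology
open scoped ComplexConjugate ENNReal

/-- The group of continuous unitary characters of the additive topological group `G`
(Mathlib's Pontryagin dual, which is written for multiplicative groups). -/
abbrev CharGroup (G : Type*) [AddCommGroup G] [TopologicalSpace G] : Type _ :=
  PontryaginDual (Multiplicative G)

/-- The value `(χ, x)` of a character at a point, as a complex number. -/
noncomputable def charVal {G : Type*} [AddCommGroup G] [TopologicalSpace G]
    (χ : CharGroup G) (x : G) : ℂ :=
  ((χ (Multiplicative.ofAdd x) : Circle) : ℂ)

/-- A zero-dimensional group with a dilation operator: a basic chain `(Gₙ)` of open subgroups whose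
consecutive quotients have prime order `p`, a basic system `(gₙ)`, a Rademacher system `(rₙ)`, and
the operator `𝒜 : ∑ aₙ gₙ ↦ ∑ aₙ gₙ₋₁`, which is required to be additive. -/
structure ZeroDimGroup (G : Type*) [AddCommGroup G] [TopologicalSpace G] (p : ℕ) where
  prime : p.Prime
  /-- the basic chain -/
  chain : ℤ → AddSubgroup G
  isOpen_chain : ∀ n, IsOpen (chain n : Set G)
  chain_succ_le : ∀ n, chain (n + 1) ≤ chain n
  exists_mem_chain : ∀ x, ∃ n, x ∈ chain n
  eq_zero_of_mem_chain : ∀ x, (∀ n, x ∈ chain n) → x = 0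
  /-- the chain is a neighbourhood base at `0` -/
  exists_chain_subset : ∀ U ∈ 𝓝 (0 : G), ∃ n, (chain n : Set G) ⊆ U
  relIndex_chain : ∀ n, (chain (n + 1)).relIndex (chain n) = p
  /-- the basic system -/
  g : ℤ → G
  g_mem : ∀ n, g n ∈ chain n
  g_notMem : ∀ n, g n ∉ chain (n + 1)
  /-- the Rademacher system -/
  r : ℤ → CharGroup G
  r_trivial : ∀ n, ∀ x ∈ chain (n + 1), charVal (r n) x = 1
  r_nontrivial : ∀ n, ∃ x ∈ chain n, charVal (r n) x ≠ 1
  /-- the dilation operator -/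
  dil : G ≃+ G
  /-- `dil` is the digit shift -/
  dil_hasSum : ∀ (a : ℤ → ℕ) (x : G), (∀ n, a n < p) →
    HasSum (fun n => a n • g n) x → HasSum (fun n => a n • g (n - 1)) (dil x)

namespace ZeroDimGroup

section

variable {G : Type*} [AddCommGroup G] [TopologicalSpace G] {p : ℕ} (S : ZeroDimGroup G p)

theorem chain_anti {m n : ℤ} (h : m ≤ n) : S.chain n ≤ S.chain m :=
  antitone_int_of_succ_le S.chain_succ_le h

theorem exists_digit (n : ℤ) (x : G) (hx : x ∈ S.chain n) :
    ∃ a : ℕ, a < p ∧ x - a • S.g n ∈ S.chain (n + 1) := by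
  have : Fact p.Prime := ⟨S.prime⟩
  set K := (S.chain (n + 1)).addSubgroupOf (S.chain n) with hK
  have hcard : Nat.card (S.chain n ⧸ K) = p := S.relIndex_chain n
  have hg : ((⟨S.g n, S.g_mem n⟩ : S.chain n) : S.chain n ⧸ K) ≠ 0 := by
    rw [Ne, QuotientAddGroup.eq_zero_iff, hK, AddSubgroup.mem_addSubgroupOf]
    exact S.g_notMem n
  obtain ⟨k, hk⟩ := AddSubgroup.mem_zmultiples_iff.1
    (mem_zmultiples_of_prime_card (g' := ((⟨x, hx⟩ : S.chain n) : S.chain n ⧸ K)) hcard hg)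
  have hp0 : (p : ℤ) ≠ 0 := by exact_mod_cast S.prime.ne_zero
  have hpg : p • ((⟨S.g n, S.g_mem n⟩ : S.chain n) : S.chain n ⧸ K) = 0 := by
    have h := card_nsmul_eq_zero' (x := ((⟨S.g n, S.g_mem n⟩ : S.chain n) : S.chain n ⧸ K))
    rwa [hcard] at h
  refine ⟨(k % p).toNat, ?_, ?_⟩
  · have := Int.emod_lt_of_pos k (show (0 : ℤ) < p by exact_mod_cast S.prime.pos)
    have := Int.emod_nonneg k hp0
    omega
  · have h1 : (((k % p).toNat : ℕ) • ((⟨S.g n, S.g_mem n⟩ : S.chain n) : S.chain n ⧸ K)) =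
        ((⟨x, hx⟩ : S.chain n) : S.chain n ⧸ K) := by
      rw [← hk, ← natCast_zsmul, Int.toNat_of_nonneg (Int.emod_nonneg k hp0)]
      conv_rhs => rw [← Int.emod_add_mul_ediv k p]
      rw [add_zsmul, mul_comm (p : ℤ), mul_zsmul, natCast_zsmul, hpg, zsmul_zero, add_zero]
    have h2 : ((((k % p).toNat • (⟨S.g n, S.g_mem n⟩ : S.chain n) : S.chain n)) :
        S.chain n ⧸ K) = ((⟨x, hx⟩ : S.chain n) : S.chain n ⧸ K) := h1
    have h3 := QuotientAddGroup.eq.1 h2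
    rw [hK, AddSubgroup.mem_addSubgroupOf] at h3
    simpa [sub_eq_add_neg, add_comm] using h3

theorem smul_g_notMem (n : ℤ) (a : ℕ) (h0 : a ≠ 0) (ha : a < p) :
    a • S.g n ∉ S.chain (n + 1) := by
  intro h
  set K := (S.chain (n + 1)).addSubgroupOf (S.chain n) with hK
  have hcard : Nat.card (S.chain n ⧸ K) = p := S.relIndex_chain n
  have hpg : p • ((⟨S.g n, S.g_mem n⟩ : S.chain n) : S.chain n ⧸ K) = 0 := by
    have h := card_nsmul_eq_zero' (x := ((⟨S.g n, S.g_mem n⟩ : S.chain n) : S.chain n ⧸ K))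
    rwa [hcard] at h
  have hpm : p • S.g n ∈ S.chain (n + 1) := by
    have h2 : (((p • (⟨S.g n, S.g_mem n⟩ : S.chain n) : S.chain n)) : S.chain n ⧸ K) = 0 := hpg
    rw [QuotientAddGroup.eq_zero_iff, hK, AddSubgroup.mem_addSubgroupOf] at h2
    simpa using h2
  have hco : Nat.Coprime a p := (Nat.coprime_of_lt_prime h0 ha S.prime).symm
  apply S.g_notMem n
  have hb := Nat.gcd_eq_gcd_ab a p
  rw [hco] at hb
  have : S.g n = (Nat.gcdA a p) • (a • S.g n) + (Nat.gcdB a p) • (p • S.g n) := by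
    rw [← natCast_zsmul, ← natCast_zsmul, ← mul_zsmul, ← mul_zsmul, ← add_zsmul]
    rw [mul_comm (Nat.gcdA a p), mul_comm (Nat.gcdB a p), ← hb]
    simp
  rw [this]
  exact add_mem (zsmul_mem h _) (zsmul_mem hpm _)

theorem exists_expansion [IsTopologicalAddGroup G] (m : ℤ) (x : G) (hx : x ∈ S.chain m) :
    ∃ a : ℤ → ℕ, (∀ n, a n < p) ∧ (∀ n, n < m → a n = 0) ∧ HasSum (fun n => a n • S.g n) x := by
  have step : ∀ (n : ℤ) (y : G), ∃ a : ℕ, a < p ∧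
      (y ∈ S.chain n → y - a • S.g n ∈ S.chain (n + 1)) := by
    intro n y
    by_cases hy : y ∈ S.chain n
    · obtain ⟨a, h1, h2⟩ := S.exists_digit n y hy
      exact ⟨a, h1, fun _ => h2⟩
    · exact ⟨0, S.prime.pos, fun h => absurd h hy⟩
  choose d hd hd' using step
  let R : ℕ → G := fun i => Nat.rec x (fun i y => y - d (m + i) y • S.g (m + i)) i
  have hR : ∀ i : ℕ, R i ∈ S.chain (m + i) := by
    intro i
    induction i with
    | zero => simpa [R] using hx
    | succ i ih =>
      have := hd' _ _ ih
      push_cast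
      rw [← add_assoc]
      exact this
  have hsum : ∀ i, ∑ k ∈ Finset.range i, d (m + k) (R k) • S.g (m + k) = x - R i := by
    intro i
    induction i with
    | zero => simp [R]
    | succ i ih =>
      rw [Finset.sum_range_succ, ih]
      have : R (i + 1) = R i - d (m + i) (R i) • S.g (m + i) := rfl
      rw [this]; abel
  have hnat : HasSum (fun k : ℕ => d (m + k) (R k) • S.g (m + k)) x := by
    rw [HasSum, SummationFilter.unconditional_filter]
    intro U hU
    have hU' : (fun y => x + y) ⁻¹' U ∈ 𝓝 (0 : G) :=
      (continuous_const.add continuous_id).continuousAt.preimage_mem_nhds (by simpa using hU)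
    obtain ⟨n, hn⟩ := S.exists_chain_subset _ hU'
    rw [Filter.mem_map, Filter.mem_atTop_sets]
    refine ⟨Finset.range (n - m).toNat, fun T hT => ?_⟩
    have hle : n ≤ m + ((n - m).toNat : ℤ) := by omega
    have hT' : ∑ k ∈ T \ Finset.range (n - m).toNat, d (m + k) (R k) • S.g (m + k) ∈ S.chain n := by
      refine sum_mem fun k hk => nsmul_mem (S.chain_anti ?_ (S.g_mem _)) _
      simp only [Finset.mem_sdiff, Finset.mem_range] at hk
      omega
    have key := hn (sub_mem hT' (S.chain_anti hle (hR _)))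
    have e := Finset.sum_sdiff (f := fun k : ℕ => d (m + k) (R k) • S.g (m + k)) hT
    rw [hsum] at e
    simp only [Set.mem_preimage] at key ⊢
    rw [← e]
    convert key using 1
    abel
  have hinj : Function.Injective (fun k : ℕ => m + (k : ℤ)) := fun a b h => by
    simpa using h
  refine ⟨fun n => if m ≤ n then d n (R (n - m).toNat) else 0, fun n => ?_, fun n hn => ?_, ?_⟩
  · dsimp only
    split_ifs
    · exact hd _ _
    · exact S.prime.pos
  · simp [not_le.2 hn]
  · rw [← hinj.hasSum_iff]
    · convert hnat using 1
      funext k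
      simp
    · intro n hn
      have : ¬ m ≤ n := fun h => hn ⟨(n - m).toNat, by simp; omega⟩
      simp [this]

theorem isClosed_chain [IsTopologicalAddGroup G] (n : ℤ) : IsClosed (S.chain n : Set G) :=
  AddSubgroup.isClosed_of_isOpen _ (S.isOpen_chain n)

theorem t2Space (S : ZeroDimGroup G p) [IsTopologicalAddGroup G] : T2Space G := by
  have : IsClosed ({0} : Set G) := by
    have h : ({0} : Set G) = ⋂ n, (S.chain n : Set G) := by
      ext x
      simp only [Set.mem_singleton_iff, Set.mem_iInter, SetLike.mem_coe]
      exact ⟨fun h n => h ▸ zero_mem _, S.eq_zero_of_mem_chain x⟩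
    rw [h]
    exact isClosed_iInter S.isClosed_chain
  have : T1Space G := IsTopologicalAddGroup.t1Space G this
  infer_instance

theorem dil_g [IsTopologicalAddGroup G] (n : ℤ) : S.dil (S.g n) = S.g (n - 1) := by
  have := S.t2Space
  have h := S.dil_hasSum (Pi.single n 1) (S.g n)
    (fun k => by
      by_cases hk : k = n
      · subst hk; simpa using S.prime.one_lt
      · simpa [hk] using S.prime.pos)
    (by
      convert hasSum_single n (f := fun k => (Pi.single n 1 : ℤ → ℕ) k • S.g k) ?_ using 1
      · simp
      · intro k hk; simp [hk])
  refine h.unique ?_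
  convert hasSum_single n (f := fun k => (Pi.single n 1 : ℤ → ℕ) k • S.g (k - 1)) ?_ using 1
  · simp
  · intro k hk; simp [hk]

theorem dil_mem [IsTopologicalAddGroup G] (n : ℤ) (x : G) (hx : x ∈ S.chain n) :
    S.dil x ∈ S.chain (n - 1) := by
  obtain ⟨a, ha, ha0, hs⟩ := S.exists_expansion n x hx
  have h := S.dil_hasSum a x ha hs
  rw [HasSum, SummationFilter.unconditional_filter] at h
  refine (S.isClosed_chain (n - 1)).mem_of_tendsto h (Eventually.of_forall fun T => ?_)
  refine sum_mem fun k _ => ?_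
  by_cases hk : k < n
  · simp [ha0 k hk]
  · exact nsmul_mem (S.chain_anti (by omega) (S.g_mem _)) _

theorem mem_of_dil_mem [IsTopologicalAddGroup G] (n : ℤ) (x : G)
    (hx : S.dil x ∈ S.chain (n - 1)) : x ∈ S.chain n := by
  obtain ⟨m, hm⟩ := S.exists_mem_chain x
  have key : ∀ i : ℕ, m + i ≤ n → x ∈ S.chain (m + i) := by
    intro i
    induction i with
    | zero => intro _; simpa using hm
    | succ i ih =>
      intro hi
      push_cast at hi ⊢
      have hxi := ih (by omega)
      obtain ⟨a, ha, hxa⟩ := S.exists_digit _ x hxi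
      rw [← add_assoc]
      by_cases h0 : a = 0
      · simpa [h0] using hxa
      · exfalso
        have h1 := S.dil_mem _ _ hxa
        rw [map_sub, map_nsmul, S.dil_g] at h1
        have h2 : S.dil x ∈ S.chain (m + i + 1 - 1) := S.chain_anti (by omega) hx
        have h3 := sub_mem h2 h1
        rw [sub_sub_cancel] at h3
        refine S.smul_g_notMem (m + i - 1) a h0 ha ?_
        convert h3 using 2
        ring
  by_cases h : m ≤ n
  · have := key (n - m).toNat (by omega)
    rwa [show m + ((n - m).toNat : ℤ) = n by omega] at this
  · exact S.chain_anti (by omega) hm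

/-- The power `𝒜ᵏ`, `k ∈ ℤ`: Mathlib writes the composition of additive automorphisms
additively. -/
def dilPow (k : ℤ) : G ≃+ G := k • (show AddAut G from S.dil)

theorem dilPow_zero (x : G) : S.dilPow 0 x = x := by
  simp [dilPow]

theorem dilPow_add_one (k : ℤ) (x : G) : S.dilPow (k + 1) x = S.dilPow k (S.dil x) := by
  simp only [dilPow, add_zsmul, one_zsmul]; rfl

theorem continuous_dilPow [IsTopologicalAddGroup G] (k : ℤ) : Continuous (S.dilPow k) := by
  have hmem : ∀ (k n : ℤ) (x : G), x ∈ S.chain n → S.dilPow k x ∈ S.chain (n - k) := by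
    intro k
    induction k with
    | zero => intro n x hx; simpa [S.dilPow_zero] using hx
    | succ i ih =>
      intro n x hx
      rw [S.dilPow_add_one, show n - ((i : ℤ) + 1) = n - 1 - i by ring]
      exact ih _ _ (S.dil_mem _ _ hx)
    | pred i ih =>
      intro n x hx
      obtain ⟨y, rfl⟩ := S.dil.surjective x
      rw [← S.dilPow_add_one, show n - (-(i : ℤ) - 1) = n + 1 - (-(i : ℤ) - 1 + 1) by ring,
        show (-(i : ℤ) - 1 + 1) = -(i : ℤ) by ring]
      exact ih _ _ (S.mem_of_dil_mem _ _ (by simpa using hx))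
  refine continuous_of_continuousAt_zero (S.dilPow k).toAddMonoidHom ?_
  intro U hU
  simp only [AddEquiv.toAddMonoidHom_eq_coe, map_zero] at hU
  obtain ⟨n, hn⟩ := S.exists_chain_subset U hU
  refine Filter.mem_map.2 <| Filter.mem_of_superset ((S.isOpen_chain (n + k)).mem_nhds (zero_mem _)) fun x hx => hn ?_
  simpa using hmem k _ x hx

end

noncomputable section

variable {G : Type*} [AddCommGroup G] [TopologicalSpace G] [IsTopologicalAddGroup G]
  {p : ℕ} (S : ZeroDimGroup G p)

/-- `χ𝒜ᵏ`, the character `x ↦ (χ, 𝒜ᵏ x)`. -/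
def charDil (k : ℤ) (χ : CharGroup G) : CharGroup G :=
  PontryaginDual.map
    (⟨AddMonoidHom.toMultiplicative (S.dilPow k).toAddMonoidHom, S.continuous_dilPow k⟩ :
      Multiplicative G →ₜ* Multiplicative G) χ

theorem charVal_charDil (k : ℤ) (χ : CharGroup G) (x : G) :
    charVal (S.charDil k χ) x = charVal χ (S.dilPow k x) := rfl

/-- The annihilator `Gₙ^⊥`. -/
def ann (n : ℤ) : Set (CharGroup G) := {χ | ∀ x ∈ S.chain n, charVal χ x = 1}

/-- The coset `G₋ₛ^⊥ r₋ₛ^{α₋ₛ} ⋯ r_M^{α_M}`. -/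
def coset (s M : ℕ) (α : ℤ → Fin p) : Set (CharGroup G) :=
  {χ | ∃ η ∈ S.ann (-(s : ℤ)),
    χ = η * ∏ k ∈ Finset.Icc (-(s : ℤ)) (M : ℤ), S.r k ^ (α k : ℕ)}

/-- The set `H₀` of all sums `a₋₁ g₋₁ + ⋯ + a₋ₛ g₋ₛ` with digits `0 ≤ aₖ < p`. -/
def H₀ : Set G :=
  {h | ∃ (s : ℕ) (a : ℤ → Fin p), h = ∑ k ∈ Finset.Icc (-(s : ℤ)) (-1), (a k : ℕ) • S.g k}

/-- The class of step functions that are supported on `G₋N` and constant on the cosets of `G_M`. -/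
def IsStep (M N : ℕ) (f : G → ℂ) : Prop :=
  Function.support f ⊆ (S.chain (-(N : ℤ)) : Set G) ∧
    ∀ x, ∀ y ∈ S.chain (M : ℤ), f (x + y) = f x

/-- `φ` satisfies `φ(x) = p ∑_{h ∈ H₀} β_h φ(𝒜x - h)` for some `β ∈ ℓ²`, and
`m₀(χ) = ∑_{h ∈ H₀} β_h conj (χ𝒜⁻¹, h)` is its mask; the last series is understood in `L²` on every
annihilator `Gₙ^⊥`. For a step function `φ` the first series has finitely many nonzero terms
at each point. -/
def IsRefinable [MeasurableSpace (CharGroup G)] (ν : Measure (CharGroup G))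
    (φ : G → ℂ) (m₀ : CharGroup G → ℂ) : Prop :=
  ∃ β : S.H₀ → ℂ, Summable (fun h => ‖β h‖ ^ 2) ∧
    (∀ x, HasSum (fun h : S.H₀ => (p : ℂ) * β h * φ (S.dil x - h)) (φ x)) ∧
    ∀ n : ℤ, Tendsto
      (fun T : Finset S.H₀ => eLpNorm
        (fun χ => m₀ χ - ∑ h ∈ T, β h * conj (charVal (S.charDil (-1) χ) h))
        2 (ν.restrict (S.ann n))) atTop (𝓝 0)

end

end ZeroDimGroup

noncomputable section

/-- The Fourier transform `f̂(χ) = ∫ f(x) conj (χ, x) dμ(x)` (used for integrable `f`). -/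
def fourierTr {G : Type*} [AddCommGroup G] [TopologicalSpace G] [MeasurableSpace G]
    (μ : Measure G) (f : G → ℂ) (χ : CharGroup G) : ℂ :=
  ∫ x, f x * conj (charVal χ x) ∂μ

/-- The inverse Fourier transform `x ↦ ∫ F(χ) (χ, x) dν(χ)` (used for integrable `F`). -/
def invFourierTr {G : Type*} [AddCommGroup G] [TopologicalSpace G]
    [MeasurableSpace (CharGroup G)] (ν : Measure (CharGroup G)) (F : CharGroup G → ℂ) (x : G) : ℂ :=
  ∫ χ, F χ * charVal χ x ∂ν

namespace ZeroDimGroup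

variable {G : Type*} [AddCommGroup G] [TopologicalSpace G] [IsTopologicalAddGroup G]
  {p : ℕ} (S : ZeroDimGroup G p)

/-- The function `ψ` generated by `φ` and a mask `m`: `ψ̂(χ) = φ̂(χ𝒜⁻¹) m(χ)`. -/
def wavelet [MeasurableSpace G] [MeasurableSpace (CharGroup G)]
    (μ : Measure G) (ν : Measure (CharGroup G)) (φ : G → ℂ) (m : CharGroup G → ℂ) : G → ℂ :=
  invFourierTr ν (fun χ => fourierTr μ φ (S.charDil (-1) χ) * m χ)

/-- `ψ_{n,h}(x) = p^{n/2} ψ(𝒜ⁿ x - h)`. -/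
def affine (ψ : G → ℂ) (n : ℤ) (h : G) (x : G) : ℂ :=
  (((p : ℝ) ^ ((n : ℝ) / 2) : ℝ) : ℂ) * ψ (S.dilPow n x - h)

end ZeroDimGroup

/-- A Parseval (tight) frame of a Hilbert space: `∑ |⟨f, eᵢ⟩|² = ‖f‖²` and `∑ ⟨f, eᵢ⟩ eᵢ = f`
for every `f`. -/
def IsParsevalFrame {ι H : Type*} [NormedAddCommGroup H] [InnerProductSpace ℂ H]
    (e : ι → H) : Prop :=
  ∀ f : H, HasSum (fun i => ‖inner ℂ (e i) f‖ ^ 2) (‖f‖ ^ 2) ∧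
    HasSum (fun i => inner ℂ (e i) f • e i) f

end

/- Dilation carries `G_{M+1}^⊥ \ G_M^⊥` onto every `G_{n+1}^⊥ \ G_n^⊥`, and these sets partition
`X \ {1}`; hence so do the cosets `E_j 𝒜ᵗ`. The inverse Fourier transform of the indicator of a
coset `ρ Gₖ^⊥` is `p^{k/2}` times the wave packet `p^{k/2} 1_{Gₖ} (ρ, ·)`. The translates of the
packets attached to the cosets `E_j 𝒜ᵗ` form an orthonormal basis of `L²(G)`: the weighted packets
with frequencies in `G_{n+1}^⊥ \ G_n^⊥` add up to `p^{n+1} 1_{G_{n+1}} - pⁿ 1_{Gₙ}`, so if `f` is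
orthogonal to all translates, its averages over `y + Gₙ` do not depend on `n`; they tend to `0` as
`n → -∞`, and therefore vanish. Finally, the functions `ψ^{(j)}_{n,h}`, `h ∈ H₀`, run through the
corresponding basis elements `p^{s(j)}` times, up to factors of modulus `p^{-s(j)/2}`. -/

section

open scoped Pointwise

section HaarMeasure

@[to_additive integral_eq_zero_of_add_left_eq_smul]
theorem integral_eq_zero_of_mul_left_eq_smul {E G : Type*} [NormedAddCommGroup E]
    [NormedSpace ℂ E] [Group G] [MeasurableSpace G] [MeasurableMul G] {μ : Measure G}
    [μ.IsMulLeftInvariant] {f : G → E} {g : G} {c : ℂ} (hc : c ≠ 1)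
    (hf : ∀ x, f (g * x) = c • f x) : ∫ x, f x ∂μ = 0 := by
  have h : c • ∫ x, f x ∂μ = ∫ x, f x ∂μ := by
    rw [← integral_smul, ← integral_mul_left_eq_self f g]
    simp only [hf]
  have h' : (c - 1) • ∫ x, f x ∂μ = 0 := by rw [sub_smul, h, one_smul, sub_self]
  exact (smul_eq_zero.1 h').resolve_left (sub_ne_zero.2 hc)

@[to_additive measureReal_addSubgroup_eq_relIndex_mul]
theorem measureReal_subgroup_eq_relIndex_mul {G : Type*} [Group G] [MeasurableSpace G]
    [MeasurableMul G] (μ : Measure G) [μ.IsMulLeftInvariant] {H K : Subgroup G}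
    [H.IsFiniteRelIndex K] (hHK : H ≤ K) (hH : MeasurableSet (H : Set G)) :
    μ.real (K : Set G) = H.relIndex K * μ.real (H : Set G) := by
  have mem_iff (q : K ⧸ H.subgroupOf K) (x : K) :
      (x : G) ∈ (q.out : G) • (H : Set G) ↔ q = x := by
    rw [Set.mem_smul_set_iff_inv_smul_mem, ← QuotientGroup.out_eq' q, QuotientGroup.eq,
      QuotientGroup.out_eq']
    rfl
  have hK : (K : Set G) = ⋃ q : K ⧸ H.subgroupOf K, (q.out : G) • (H : Set G) := by
    refine Set.Subset.antisymm
      (fun x hx => Set.mem_iUnion.2 ⟨_, (mem_iff _ ⟨x, hx⟩).2 rfl⟩) fun x hx => ?_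
    obtain ⟨q, h, hh, rfl⟩ := Set.mem_iUnion.1 hx
    exact mul_mem q.out.2 (hHK hh)
  rw [hK, measureReal_def, measure_iUnion _ fun q => hH.const_smul _]
  · simp [measureReal_def, measure_smul, Subgroup.relIndex, Subgroup.index]
  · refine fun q q' hne => Set.disjoint_left.2 fun x hx hx' => hne ?_
    have hxK : x ∈ K := hK.ge (Set.mem_iUnion.2 ⟨q, hx⟩)
    exact ((mem_iff q ⟨x, hxK⟩).1 hx).trans ((mem_iff q' ⟨x, hxK⟩).1 hx').symm

end HaarMeasure

theorem eq_zpow_of_add_one {α : Type*} [GroupWithZero α] {a : α} (ha : a ≠ 0) {u : ℤ → α}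
    (h0 : u 0 = 1) (hu : ∀ n, u (n + 1) = a * u n) (n : ℤ) : u n = a ^ n := by
  induction n with
  | zero => rw [h0, zpow_zero]
  | succ i ih => rw [hu, ih, add_comm, zpow_one_add₀ ha]
  | pred i ih =>
    refine mul_left_cancel₀ ha ?_
    rw [← hu, sub_add_cancel, ih, ← zpow_one_add₀ ha, add_sub_cancel]

section CharVal

variable {G : Type*} [AddCommGroup G] [TopologicalSpace G]

@[simp]
theorem norm_charVal (χ : CharGroup G) (x : G) : ‖charVal χ x‖ = 1 :=
  Circle.norm_coe _

theorem charVal_add (χ : CharGroup G) (x y : G) :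
    charVal χ (x + y) = charVal χ x * charVal χ y := by
  simp [charVal, ofAdd_add]

theorem charVal_nsmul (χ : CharGroup G) (k : ℕ) (x : G) :
    charVal χ (k • x) = charVal χ x ^ k := by
  simp [charVal]

theorem charVal_zsmul (χ : CharGroup G) (k : ℤ) (x : G) :
    charVal χ (k • x) = charVal χ x ^ k := by
  simp [charVal]

@[simp]
theorem charVal_one (x : G) : charVal (1 : CharGroup G) x = 1 := by
  simp [charVal]

theorem charVal_mul (χ η : CharGroup G) (x : G) :
    charVal (χ * η) x = charVal χ x * charVal η x :=
  rfl

theorem charVal_inv (χ : CharGroup G) (x : G) : charVal χ⁻¹ x = conj (charVal χ x) :=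
  Circle.coe_inv_eq_conj _

theorem charVal_ext {χ η : CharGroup G} (h : ∀ x, charVal χ x = charVal η x) : χ = η :=
  PontryaginDual.ext fun a => Circle.ext (h a.toAdd)

theorem continuous_charVal (χ : CharGroup G) : Continuous (charVal χ) :=
  continuous_subtype_val.comp ((map_continuous χ).comp continuous_ofAdd)

theorem continuous_charVal_left (x : G) : Continuous fun χ : CharGroup G => charVal χ x :=
  continuous_subtype_val.comp
    (continuous_eval_const (F := Multiplicative G →ₜ* Circle) (Multiplicative.ofAdd x))

end CharVal

section Annihilator

variable {G : Type*} [AddCommGroup G] [TopologicalSpace G]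

/-- The annihilator `K^⊥` of a subgroup `K` in the dual group. It bundles the sets
`ZeroDimGroup.ann`: the carrier of the annihilator of `S.chain n` is `S.ann n` by definition. -/
def charAnnihilator (K : AddSubgroup G) : Subgroup (CharGroup G) where
  carrier := {χ | ∀ x ∈ K, charVal χ x = 1}
  one_mem' x _ := charVal_one x
  mul_mem' hχ hη x hx := by rw [charVal_mul, hχ x hx, hη x hx, mul_one]
  inv_mem' hχ x hx := by rw [charVal_inv, hχ x hx, map_one]

theorem charAnnihilator_anti {K L : AddSubgroup G} (h : K ≤ L) :
    charAnnihilator L ≤ charAnnihilator K :=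
  fun _ hχ x hx => hχ x (h hx)

theorem isClosed_charAnnihilator (K : AddSubgroup G) :
    IsClosed (charAnnihilator K : Set (CharGroup G)) := by
  have h : (charAnnihilator K : Set (CharGroup G)) = ⋂ x ∈ K, {χ | charVal χ x = 1} := by
    ext χ
    simp only [Set.mem_iInter]
    rfl
  rw [h]
  exact isClosed_biInter fun x _ => isClosed_eq (continuous_charVal_left x) continuous_const

/-- Evaluation of characters at `x`. -/
noncomputable def charEval (x : G) : CharGroup G →* Circle where
  toFun χ := χ (Multiplicative.ofAdd x)
  map_one' := rfl
  map_mul' _ _ := rfl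

theorem charEval_eq_one_iff {x : G} {χ : CharGroup G} : charEval x χ = 1 ↔ charVal χ x = 1 :=
  Circle.coe_eq_one.symm

end Annihilator

namespace ZeroDimGroup

section Chain

variable {G : Type*} [AddCommGroup G] [TopologicalSpace G] {p : ℕ} (S : ZeroDimGroup G p)

theorem exists_sub_zsmul_mem {n : ℤ} {x y : G} (hx : x ∈ S.chain n) (hx' : x ∉ S.chain (n + 1))
    (hy : y ∈ S.chain n) : ∃ k : ℤ, y - k • x ∈ S.chain (n + 1) := by
  have : Fact p.Prime := ⟨S.prime⟩
  let K := (S.chain (n + 1)).addSubgroupOf (S.chain n)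
  have hcard : Nat.card (S.chain n ⧸ K) = p := S.relIndex_chain n
  have hx0 : ((⟨x, hx⟩ : S.chain n) : S.chain n ⧸ K) ≠ 0 := fun h =>
    hx' (AddSubgroup.mem_addSubgroupOf.1 ((QuotientAddGroup.eq_zero_iff _).1 h))
  obtain ⟨k, hk⟩ := AddSubgroup.mem_zmultiples_iff.1
    (mem_zmultiples_of_prime_card (g' := ((⟨y, hy⟩ : S.chain n) : S.chain n ⧸ K)) hcard hx0)
  have hmem : -(k • x) + y ∈ S.chain (n + 1) :=
    (QuotientAddGroup.eq (a := k • (⟨x, hx⟩ : S.chain n))).1 hk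
  exact ⟨k, by rwa [neg_add_eq_sub] at hmem⟩

theorem nsmul_mem_chain_add_one {n : ℤ} {x : G} (hx : x ∈ S.chain n) :
    p • x ∈ S.chain (n + 1) := by
  have h := AddSubgroup.nsmul_index_mem ((S.chain (n + 1)).addSubgroupOf (S.chain n)) ⟨x, hx⟩
  have hi : ((S.chain (n + 1)).addSubgroupOf (S.chain n)).index = p := S.relIndex_chain n
  rw [hi] at h
  exact AddSubgroup.mem_addSubgroupOf.1 h

theorem exists_mem_chain_notMem_chain_add_one {k : ℤ} {x : G} (hx : x ∉ S.chain k) :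
    ∃ n < k, x ∈ S.chain n ∧ x ∉ S.chain (n + 1) := by
  obtain ⟨n, hn, hmax⟩ := Int.exists_greatest_of_bdd (P := fun n => x ∈ S.chain n)
    ⟨k, fun n hn => le_of_not_gt fun h => hx (S.chain_anti h.le hn)⟩ (S.exists_mem_chain x)
  exact ⟨n, lt_of_not_ge fun h => hx (S.chain_anti h hn), hn,
    fun h => (lt_add_one n).not_ge (hmax _ h)⟩

theorem ann_mono {m n : ℤ} (h : m ≤ n) : S.ann m ⊆ S.ann n :=
  charAnnihilator_anti (S.chain_anti h)

theorem mem_ann_of_charVal_eq_one {n : ℤ} {χ : CharGroup G} {x : G} (hχ : χ ∈ S.ann (n + 1))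
    (hx : x ∈ S.chain n) (hx' : x ∉ S.chain (n + 1)) (h : charVal χ x = 1) : χ ∈ S.ann n := by
  intro y hy
  obtain ⟨k, hk⟩ := S.exists_sub_zsmul_mem hx hx' hy
  rw [← sub_add_cancel y (k • x), charVal_add, charVal_zsmul, hχ _ hk, h, one_zpow, one_mul]

theorem r_mem_ann (n : ℤ) : S.r n ∈ S.ann (n + 1) :=
  S.r_trivial n

theorem charVal_r_ne_one {n : ℤ} {x : G} (hx : x ∈ S.chain n) (hx' : x ∉ S.chain (n + 1)) :
    charVal (S.r n) x ≠ 1 := by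
  intro h
  obtain ⟨y, hy, hy1⟩ := S.r_nontrivial n
  exact hy1 (S.mem_ann_of_charVal_eq_one (S.r_mem_ann n) hx hx' h y hy)

theorem exists_mem_ann_charVal_ne_one {k : ℤ} {x : G} (hx : x ∉ S.chain k) :
    ∃ χ ∈ S.ann k, charVal χ x ≠ 1 := by
  obtain ⟨n, hnk, hn, hn'⟩ := S.exists_mem_chain_notMem_chain_add_one hx
  exact ⟨S.r n, S.ann_mono (by lia) (S.r_mem_ann n), S.charVal_r_ne_one hn hn'⟩

theorem charEval_pow_eq_one {n : ℤ} {x : G} (hx : x ∈ S.chain n) {χ : CharGroup G}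
    (hχ : χ ∈ S.ann (n + 1)) : charEval x χ ^ p = 1 := by
  rw [← Circle.coe_eq_one, Circle.coe_pow]
  exact (charVal_nsmul χ p x).symm.trans (hχ _ (S.nsmul_mem_chain_add_one hx))

theorem orderOf_charEval_r (n : ℤ) : orderOf (charEval (S.g n) (S.r n)) = p := by
  have : Fact p.Prime := ⟨S.prime⟩
  refine orderOf_eq_prime (S.charEval_pow_eq_one (S.g_mem n) (S.r_mem_ann n)) ?_
  rw [Ne, charEval_eq_one_iff]
  exact S.charVal_r_ne_one (S.g_mem n) (S.g_notMem n)

theorem relIndex_charAnnihilator_chain (n : ℤ) :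
    (charAnnihilator (S.chain n)).relIndex (charAnnihilator (S.chain (n + 1))) = p := by
  have hann : (charEval (S.g n)).ker ⊓ charAnnihilator (S.chain (n + 1)) =
      charAnnihilator (S.chain n) := by
    ext χ
    refine ⟨fun h => S.mem_ann_of_charVal_eq_one h.2 (S.g_mem n) (S.g_notMem n)
      (charEval_eq_one_iff.1 h.1), fun h => ⟨charEval_eq_one_iff.2 (h _ (S.g_mem n)),
      S.ann_mono (by lia) h⟩⟩
  have hroot : IsPrimitiveRoot (charVal (S.r n) (S.g n)) (orderOf (charEval (S.g n) (S.r n))) :=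
    (IsPrimitiveRoot.orderOf (charEval (S.g n) (S.r n))).map_of_injective
      (f := Circle.coeHom) Circle.coe_injective
  rw [S.orderOf_charEval_r] at hroot
  have himage : (charAnnihilator (S.chain (n + 1))).map (charEval (S.g n)) =
      Subgroup.zpowers (charEval (S.g n) (S.r n)) := by
    refine le_antisymm ?_ (Subgroup.zpowers_le.2 ⟨S.r n, S.r_mem_ann n, rfl⟩)
    rintro _ ⟨χ, hχ, rfl⟩
    have : NeZero p := ⟨S.prime.ne_zero⟩
    obtain ⟨i, -, hi⟩ := hroot.eq_pow_of_pow_eq_one (ξ := charVal χ (S.g n)) (by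
      rw [← charVal_nsmul, hχ _ (S.nsmul_mem_chain_add_one (S.g_mem n))])
    exact ⟨i, Circle.ext ((zpow_natCast _ i).trans hi)⟩
  rw [← hann, Subgroup.inf_relIndex_right, Subgroup.relIndex_ker, himage, Nat.card_zpowers,
    S.orderOf_charEval_r]

end Chain

section Dilation

variable {G : Type*} [AddCommGroup G] [TopologicalSpace G] {p : ℕ} (S : ZeroDimGroup G p)

theorem dilPow_add (k l : ℤ) (x : G) : S.dilPow (k + l) x = S.dilPow k (S.dilPow l x) := by
  simp only [dilPow, add_zsmul]
  rfl

@[simp]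
theorem dilPow_dilPow_neg (k : ℤ) (x : G) : S.dilPow k (S.dilPow (-k) x) = x := by
  rw [← S.dilPow_add, add_neg_cancel, S.dilPow_zero]

theorem coset_eq_smul_ann (s M : ℕ) (α : ℤ → Fin p) :
    S.coset s M α =
      (∏ k ∈ Finset.Icc (-(s : ℤ)) (M : ℤ), S.r k ^ (α k : ℕ)) • S.ann (-(s : ℤ)) := by
  ext χ
  simp only [coset, Set.mem_smul_set, smul_eq_mul, mul_comm, eq_comm, Set.mem_ofPred_eq]

variable [IsTopologicalAddGroup G]

theorem dilPow_mem_iff (k n : ℤ) (x : G) : S.dilPow k x ∈ S.chain n ↔ x ∈ S.chain (n + k) := by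
  have dil_mem_iff (n : ℤ) (x : G) : S.dil x ∈ S.chain n ↔ x ∈ S.chain (n + 1) :=
    ⟨fun h => S.mem_of_dil_mem _ _ (by rwa [add_sub_cancel_right]),
      fun h => add_sub_cancel_right n 1 ▸ S.dil_mem _ _ h⟩
  suffices h : ∀ n x, S.dilPow k x ∈ S.chain n ↔ x ∈ S.chain (n + k) from h n x
  induction k with
  | zero => intro n x; rw [S.dilPow_zero, add_zero]
  | succ i ih => intro n x; rw [S.dilPow_add_one, ih, dil_mem_iff, add_assoc]
  | pred i ih =>
    intro n x
    obtain ⟨y, rfl⟩ := S.dil.surjective x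
    rw [← S.dilPow_add_one, sub_add_cancel, ih, dil_mem_iff, add_assoc, sub_add_cancel]

theorem charDil_zero (χ : CharGroup G) : S.charDil 0 χ = χ :=
  charVal_ext fun x => by rw [charVal_charDil, S.dilPow_zero]

theorem charDil_charDil (k l : ℤ) (χ : CharGroup G) :
    S.charDil k (S.charDil l χ) = S.charDil (k + l) χ :=
  charVal_ext fun x => by simp only [charVal_charDil, add_comm k, S.dilPow_add]

/-- The automorphism `χ ↦ χ𝒜ᵏ` of the dual group. -/
noncomputable def charDilEquiv (k : ℤ) : CharGroup G ≃* CharGroup G where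
  toFun := S.charDil k
  invFun := S.charDil (-k)
  left_inv χ := by rw [S.charDil_charDil, neg_add_cancel, S.charDil_zero]
  right_inv χ := by rw [S.charDil_charDil, add_neg_cancel, S.charDil_zero]
  map_mul' χ η := charVal_ext fun x => by simp only [charVal_charDil, charVal_mul]

theorem charDil_injective (k : ℤ) : Function.Injective (S.charDil k) :=
  (S.charDilEquiv k).injective

theorem image_charDil_image_charDil (k l : ℤ) (E : Set (CharGroup G)) :
    S.charDil k '' (S.charDil l '' E) = S.charDil (k + l) '' E := by
  simp only [Set.image_image, charDil_charDil]

theorem charDil_mem_ann {k n : ℤ} {χ : CharGroup G} (h : χ ∈ S.ann n) :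
    S.charDil k χ ∈ S.ann (n + k) :=
  fun x hx => h _ ((S.dilPow_mem_iff k n x).2 hx)

theorem image_charDil_ann (k n : ℤ) : S.charDil k '' S.ann n = S.ann (n + k) := by
  refine Set.Subset.antisymm (Set.image_subset_iff.2 fun χ => S.charDil_mem_ann) fun χ hχ => ?_
  refine ⟨S.charDil (-k) χ, add_neg_cancel_right n k ▸ S.charDil_mem_ann hχ, ?_⟩
  rw [S.charDil_charDil, add_neg_cancel, S.charDil_zero]

theorem image_charDil_smul_ann (k n : ℤ) (ρ : CharGroup G) :
    S.charDil k '' (ρ • S.ann n) = S.charDil k ρ • S.ann (n + k) := by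
  rw [← S.image_charDil_ann]
  exact Set.image_smul_distrib (S.charDilEquiv k) ρ _

end Dilation

section Measures

variable {G : Type*} [AddCommGroup G] [TopologicalSpace G] {p : ℕ} (S : ZeroDimGroup G p)

theorem measureReal_chain [IsTopologicalAddGroup G] [MeasurableSpace G] [BorelSpace G]
    (μ : Measure G) [μ.IsAddLeftInvariant] (hμ : μ (S.chain 0 : Set G) = 1) (n : ℤ) :
    μ.real (S.chain n : Set G) = (p : ℝ) ^ (-n) := by
  have hp : (p : ℝ) ≠ 0 := by exact_mod_cast S.prime.ne_zero
  have step (n : ℤ) : μ.real (S.chain n : Set G) = p * μ.real (S.chain (n + 1) : Set G) := by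
    have : (S.chain (n + 1)).IsFiniteRelIndex (S.chain n) :=
      ⟨by rw [S.relIndex_chain]; exact S.prime.ne_zero⟩
    rw [measureReal_addSubgroup_eq_relIndex_mul μ (S.chain_succ_le n)
      (S.isOpen_chain _).measurableSet, S.relIndex_chain]
  have h := eq_zpow_of_add_one hp (u := fun n => μ.real (S.chain (-n) : Set G))
    (by simp [measureReal_def, hμ]) (fun n => by rw [step, neg_add_rev, neg_add_cancel_comm]) (-n)
  simpa using h

theorem measure_chain_ne_top [IsTopologicalAddGroup G] [MeasurableSpace G] [BorelSpace G]
    (μ : Measure G) [μ.IsAddLeftInvariant] (hμ : μ (S.chain 0 : Set G) = 1) (n : ℤ) :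
    μ (S.chain n : Set G) ≠ ∞ := by
  have h : μ.real (S.chain n : Set G) ≠ 0 := by
    rw [S.measureReal_chain μ hμ]
    exact zpow_ne_zero _ (Nat.cast_ne_zero.2 S.prime.ne_zero)
  exact (ENNReal.toReal_ne_zero.1 h).2

variable [MeasurableSpace (CharGroup G)]

theorem invFourierTr_indicator_one (ν : Measure (CharGroup G)) (E : Set (CharGroup G)) (x : G) :
    invFourierTr ν (E.indicator 1) x = ∫ χ, E.indicator (charVal · x) χ ∂ν := by
  refine integral_congr_ae (.of_forall fun χ => ?_)
  dsimp only
  rw [← Set.indicator_mul_left _ 1 (charVal · x)]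
  simp only [Pi.one_apply, one_mul]

variable [BorelSpace (CharGroup G)]

theorem measurableSet_smul_ann (ρ : CharGroup G) (k : ℤ) : MeasurableSet (ρ • S.ann k) :=
  (isClosed_charAnnihilator (S.chain k)).measurableSet.const_smul ρ

variable (ν : Measure (CharGroup G)) [ν.IsMulLeftInvariant]

theorem measureReal_ann (hν : ν (S.ann 0) = 1) (n : ℤ) :
    ν.real (S.ann n) = (p : ℝ) ^ n := by
  have hp : (p : ℝ) ≠ 0 := by exact_mod_cast S.prime.ne_zero
  refine eq_zpow_of_add_one hp (u := fun n => ν.real (S.ann n)) (by simp [measureReal_def, hν])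
    (fun n => ?_) n
  have : (charAnnihilator (S.chain n)).IsFiniteRelIndex (charAnnihilator (S.chain (n + 1))) :=
    ⟨by rw [S.relIndex_charAnnihilator_chain]; exact S.prime.ne_zero⟩
  refine (measureReal_subgroup_eq_relIndex_mul ν (charAnnihilator_anti (S.chain_succ_le n))
    (isClosed_charAnnihilator _).measurableSet).trans ?_
  rw [S.relIndex_charAnnihilator_chain]
  rfl

theorem measure_ann_ne_top (hν : ν (S.ann 0) = 1) (n : ℤ) : ν (S.ann n) ≠ ∞ := by
  have h : ν.real (S.ann n) ≠ 0 := by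
    rw [S.measureReal_ann ν hν]
    exact zpow_ne_zero _ (Nat.cast_ne_zero.2 S.prime.ne_zero)
  exact (ENNReal.toReal_ne_zero.1 h).2

theorem invFourierTr_indicator_smul_ann (hν : ν (S.ann 0) = 1) (ρ : CharGroup G) (k : ℤ)
    (x : G) :
    invFourierTr ν ((ρ • S.ann k).indicator 1) x =
      (p : ℂ) ^ k * (S.chain k : Set G).indicator (charVal ρ) x := by
  rw [invFourierTr_indicator_one]
  by_cases hx : x ∈ S.chain k
  · have h : (ρ • S.ann k).indicator (charVal · x) =
        (ρ • S.ann k).indicator fun _ => charVal ρ x := by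
      refine Set.indicator_congr ?_
      rintro _ ⟨η, hη, rfl⟩
      exact (charVal_mul ρ η x).trans (by rw [hη x hx, mul_one])
    rw [h, integral_indicator_const _ (S.measurableSet_smul_ann ρ k), measureReal_def,
      measure_smul, ← measureReal_def, S.measureReal_ann ν hν, Set.indicator_of_mem hx,
      Complex.real_smul]
    push_cast
    rfl
  · obtain ⟨η, hη, hηx⟩ := S.exists_mem_ann_charVal_ne_one hx
    rw [Set.indicator_of_notMem hx, mul_zero]
    refine integral_eq_zero_of_mul_left_eq_smul hηx (g := η) fun χ => ?_
    have hmem : η * χ ∈ ρ • S.ann k ↔ χ ∈ ρ • S.ann k := by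
      rw [Set.mem_smul_set_iff_inv_smul_mem, Set.mem_smul_set_iff_inv_smul_mem, smul_eq_mul,
        smul_eq_mul, mul_left_comm]
      exact (charAnnihilator (S.chain k)).mul_mem_cancel_left hη
    by_cases hχ : χ ∈ ρ • S.ann k
    · rw [Set.indicator_of_mem hχ, Set.indicator_of_mem (hmem.2 hχ), charVal_mul, smul_eq_mul]
    · rw [Set.indicator_of_notMem hχ, Set.indicator_of_notMem (mt hmem.1 hχ), smul_zero]

end Measures

end ZeroDimGroup

section InnerToLp

variable {α : Type*} [MeasurableSpace α] {μ : Measure α} {g h : α → ℂ}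

theorem inner_toLp_left (hg : MemLp g 2 μ) (f : Lp ℂ 2 μ) :
    inner ℂ hg.toLp f = ∫ x, f x * conj (g x) ∂μ := by
  rw [L2.inner_def]
  refine integral_congr_ae ?_
  filter_upwards [hg.coeFn_toLp] with x hx
  rw [hx, RCLike.inner_apply]

theorem inner_toLp_toLp (hg : MemLp g 2 μ) (hh : MemLp h 2 μ) :
    inner ℂ hg.toLp hh.toLp = ∫ x, h x * conj (g x) ∂μ := by
  rw [inner_toLp_left]
  refine integral_congr_ae ?_
  filter_upwards [hh.coeFn_toLp] with x hx
  rw [hx]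

end InnerToLp

section HalfZPow

variable {p : ℕ}

/-- The normalizing factor `p^{k/2}`. -/
noncomputable def halfZPow (p : ℕ) (k : ℤ) : ℂ := (((p : ℝ) ^ ((k : ℝ) / 2) : ℝ) : ℂ)

theorem halfZPow_add (hp : p ≠ 0) (k l : ℤ) :
    halfZPow p (k + l) = halfZPow p k * halfZPow p l := by
  rw [halfZPow, Int.cast_add, add_div, Real.rpow_add (by positivity), Complex.ofReal_mul]
  rfl

theorem halfZPow_mul_self (hp : p ≠ 0) (k : ℤ) :
    halfZPow p k * halfZPow p k = (p : ℂ) ^ k := by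
  rw [halfZPow, ← Complex.ofReal_mul, ← Real.rpow_add (by positivity), add_halves,
    Real.rpow_intCast, Complex.ofReal_zpow, Complex.ofReal_natCast]

theorem conj_halfZPow (k : ℤ) : conj (halfZPow p k) = halfZPow p k := Complex.conj_ofReal _

theorem norm_halfZPow_sq (hp : p ≠ 0) (k : ℤ) : ‖halfZPow p k‖ ^ 2 = (p : ℝ) ^ k := by
  rw [sq, ← norm_mul, halfZPow_mul_self hp, norm_zpow, Complex.norm_natCast]

theorem halfZPow_ne_zero (hp : p ≠ 0) (k : ℤ) : halfZPow p k ≠ 0 :=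
  left_ne_zero_of_mul <| (halfZPow_mul_self hp k).symm ▸ zpow_ne_zero k (Nat.cast_ne_zero.2 hp)

theorem tendsto_halfZPow_atBot (hp : 1 < p) : Tendsto (halfZPow p) atBot (𝓝 0) := by
  have hlim : Tendsto (fun k : ℤ => (p : ℝ) ^ ((k : ℝ) / 2)) atBot (𝓝 0) :=
    (tendsto_rpow_atBot_of_base_gt_one _ (Nat.one_lt_cast.2 hp)).comp
      ((tendsto_intCast_atBot_iff.2 tendsto_id).atBot_div_const two_pos)
  exact hlim.ofReal

end HalfZPow

namespace ZeroDimGroup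

section Packets

variable {G : Type*} [AddCommGroup G] [TopologicalSpace G] {p : ℕ} (S : ZeroDimGroup G p)

/-- The wave packet at `y + Gₖ` with frequencies in `ρ Gₖ^⊥`: the character `ρ`, translated by `y`
and cut off to `y + Gₖ`. The factor `p^{k/2}` gives it norm one in `L²` for the Haar measure that is
one on `G₀`. -/
noncomputable def packet (ρ : CharGroup G) (k : ℤ) (y x : G) : ℂ :=
  halfZPow p k * (S.chain k : Set G).indicator (charVal ρ) (x - y)

theorem indicator_charVal_add (ρ : CharGroup G) {k : ℤ} {z : G} (hz : z ∈ S.chain k) (x : G) :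
    (S.chain k : Set G).indicator (charVal ρ) (z + x) =
      charVal ρ z * (S.chain k : Set G).indicator (charVal ρ) x := by
  have hmem : z + x ∈ (S.chain k : Set G) ↔ x ∈ (S.chain k : Set G) :=
    AddSubgroup.add_mem_cancel_left _ hz
  by_cases hx : x ∈ (S.chain k : Set G)
  · rw [Set.indicator_of_mem hx, Set.indicator_of_mem (hmem.2 hx), charVal_add]
  · rw [Set.indicator_of_notMem hx, Set.indicator_of_notMem (mt hmem.1 hx), mul_zero]

theorem packet_add (ρ : CharGroup G) {k : ℤ} {z : G} (hz : z ∈ S.chain k) (y x : G) :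
    S.packet ρ k y (z + x) = charVal ρ z * S.packet ρ k y x := by
  rw [packet, add_sub_assoc, S.indicator_charVal_add ρ hz, packet, mul_left_comm]

theorem packet_eq_charVal_mul (ρ : CharGroup G) {k : ℤ} {y y' : G} (h : y - y' ∈ S.chain k)
    (x : G) : S.packet ρ k y' x = charVal ρ (y - y') * S.packet ρ k y x := by
  rw [← S.packet_add ρ h, packet, packet, add_sub_assoc, sub_add_sub_cancel']

theorem packet_mul_conj_packet (ρ : CharGroup G) (k : ℤ) (y x : G) :
    S.packet ρ k y x * conj (S.packet ρ k y x) =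
      (S.chain k : Set G).indicator (fun _ => (p : ℂ) ^ k) (x - y) := by
  by_cases hx : x - y ∈ (S.chain k : Set G)
  · rw [Complex.mul_conj', packet, norm_mul, Set.indicator_of_mem hx, Set.indicator_of_mem hx,
      norm_charVal, mul_one, ← Complex.ofReal_pow, norm_halfZPow_sq S.prime.ne_zero,
      Complex.ofReal_zpow, Complex.ofReal_natCast]
  · rw [packet, Set.indicator_of_notMem hx, Set.indicator_of_notMem hx, mul_zero, zero_mul]

theorem affine_smul (c : ℂ) (ψ : G → ℂ) (n : ℤ) (h : G) :
    S.affine (c • ψ) n h = c • S.affine ψ n h :=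
  funext fun _ => mul_left_comm _ _ _

theorem invFourierTr_indicator_smul_ann_eq_packet [MeasurableSpace (CharGroup G)]
    [BorelSpace (CharGroup G)] (ν : Measure (CharGroup G)) [ν.IsMulLeftInvariant]
    (hν : ν (S.ann 0) = 1) (ρ : CharGroup G) (k : ℤ) :
    invFourierTr ν ((ρ • S.ann k).indicator 1) = halfZPow p k • S.packet ρ k 0 := by
  funext x
  rw [S.invFourierTr_indicator_smul_ann ν hν, Pi.smul_apply, packet, smul_eq_mul, ← mul_assoc,
    halfZPow_mul_self S.prime.ne_zero, sub_zero]

variable [IsTopologicalAddGroup G]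

theorem affine_packet (ρ : CharGroup G) (k n : ℤ) (h : G) :
    S.affine (S.packet ρ k 0) n h =
      S.packet (S.charDil n ρ) (k + n) (S.dilPow (-n) h) := by
  have hchain : (S.chain (k + n) : Set G) = S.dilPow n ⁻¹' S.chain k :=
    Set.ext fun u => (S.dilPow_mem_iff n k u).symm
  funext x
  have hx : S.dilPow n x - h = S.dilPow n (x - S.dilPow (-n) h) := by
    rw [map_sub, S.dilPow_dilPow_neg]
  rw [affine, ← halfZPow, packet, packet, ← mul_assoc, ← halfZPow_add S.prime.ne_zero, add_comm n,
    sub_zero, hx, hchain]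
  exact congrArg _ (Set.indicator_comp_right (S.dilPow n)).symm

variable [MeasurableSpace G] [BorelSpace G] (μ : Measure G) [μ.IsAddLeftInvariant]
  (hμ : μ (S.chain 0 : Set G) = 1)

include hμ in
theorem memLp_packet (ρ : CharGroup G) (k : ℤ) (y : G) : MemLp (S.packet ρ k y) 2 μ := by
  have : IsFiniteMeasure (μ.restrict (S.chain k : Set G)) :=
    isFiniteMeasure_restrict.2 (S.measure_chain_ne_top μ hμ k)
  have hind : MemLp ((S.chain k : Set G).indicator (charVal ρ)) 2 μ :=
    (memLp_indicator_iff_restrict (S.isOpen_chain k).measurableSet).2 <|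
      .of_bound (continuous_charVal ρ).aestronglyMeasurable 1 (.of_forall fun x =>
        (norm_charVal ρ x).le)
  exact (hind.comp_measurePreserving (measurePreserving_sub_right μ y)).const_mul _

/-- The wave packet `S.packet ρ k y` as an element of `L²`. -/
noncomputable def packetLp (ρ : CharGroup G) (k : ℤ) (y : G) : Lp ℂ 2 μ :=
  (S.memLp_packet μ hμ ρ k y).toLp

theorem packetLp_eq_charVal_smul (ρ : CharGroup G) {k : ℤ} {y y' : G} (h : y - y' ∈ S.chain k) :
    S.packetLp μ hμ ρ k y' = charVal ρ (y - y') • S.packetLp μ hμ ρ k y := by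
  rw [packetLp, packetLp, ← MemLp.toLp_const_smul]
  congr 1
  exact funext fun x => S.packet_eq_charVal_mul ρ h x

theorem norm_packetLp (ρ : CharGroup G) (k : ℤ) (y : G) : ‖S.packetLp μ hμ ρ k y‖ = 1 := by
  have hp : (p : ℂ) ≠ 0 := by exact_mod_cast S.prime.ne_zero
  have hself : inner ℂ (S.packetLp μ hμ ρ k y) (S.packetLp μ hμ ρ k y) = 1 := by
    rw [packetLp, inner_toLp_toLp]
    simp only [packet_mul_conj_packet]
    rw [integral_sub_right_eq_self ((S.chain k : Set G).indicator fun _ => (p : ℂ) ^ k),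
      integral_indicator_const _ (S.isOpen_chain k).measurableSet, S.measureReal_chain μ hμ,
      Complex.real_smul]
    push_cast
    rw [← zpow_add₀ hp, neg_add_cancel, zpow_zero]
  rw [norm_eq_sqrt_re_inner (𝕜 := ℂ), hself, RCLike.one_re, Real.sqrt_one]

theorem inner_packetLp_of_sub_notMem (ρ : CharGroup G) {k : ℤ} {y y' : G}
    (h : y - y' ∉ S.chain k) :
    inner ℂ (S.packetLp μ hμ ρ k y) (S.packetLp μ hμ ρ k y') = 0 := by
  rw [packetLp, packetLp, inner_toLp_toLp]
  refine integral_eq_zero_of_ae (.of_forall fun x => ?_)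
  by_cases hx : x - y ∈ S.chain k
  · have hx' : x - y' ∉ (S.chain k : Set G) := fun hx' =>
      h (by simpa only [sub_sub_sub_cancel_left] using sub_mem hx' hx)
    simp only [packet, Set.indicator_of_notMem hx', mul_zero, zero_mul, Pi.zero_apply]
  · have hx' : x - y ∉ (S.chain k : Set G) := hx
    simp only [packet, Set.indicator_of_notMem hx', mul_zero, map_zero, Pi.zero_apply]

theorem inner_packetLp_of_disjoint {ρ ρ' : CharGroup G} {k k' : ℤ}
    (h : Disjoint (ρ • S.ann k) (ρ' • S.ann k')) (y y' : G) :
    inner ℂ (S.packetLp μ hμ ρ k y) (S.packetLp μ hμ ρ' k' y') = 0 := by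
  wlog hk : k' ≤ k generalizing ρ ρ' k k' y y'
  · exact inner_eq_zero_symm.1 (this h.symm y' y (le_of_not_ge hk))
  have hnot : ρ⁻¹ * ρ' ∉ S.ann k := fun hmem =>
    Set.disjoint_left.1 h ⟨_, hmem, mul_inv_cancel_left ρ ρ'⟩
      ⟨1, (charAnnihilator (S.chain k')).one_mem, mul_one ρ'⟩
  obtain ⟨z, hz, hz1⟩ : ∃ z ∈ S.chain k, charVal (ρ⁻¹ * ρ') z ≠ 1 := by
    simpa only [ann, Set.mem_ofPred_eq, not_forall, exists_prop] using hnot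
  rw [packetLp, packetLp, inner_toLp_toLp]
  refine integral_eq_zero_of_add_left_eq_smul hz1 (g := z) fun x => ?_
  rw [S.packet_add ρ hz, S.packet_add ρ' (S.chain_anti hk hz), map_mul, charVal_mul, charVal_inv,
    smul_eq_mul]
  ring

end Packets

end ZeroDimGroup

@[to_additive card_addTransversal_inter_leftAddCoset]
theorem card_transversal_inter_leftCoset {A : Type*} [Group A] {T : Set A} {K L : Subgroup A}
    (hT : Subgroup.IsComplement T (K : Set A)) (hKL : K ≤ L) (z : A) :
    Nat.card {t : T // z⁻¹ * t ∈ L} = K.relIndex L := by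
  refine Nat.card_eq_of_bijective
    (fun t => ((⟨_, t.2⟩ : L) : L ⧸ K.subgroupOf L)) ⟨fun t t' h => ?_, fun c => ?_⟩
  · have hK : ((t : T) : A)⁻¹ * (t' : T) ∈ K := by
      simpa [Subgroup.mem_subgroupOf, mul_assoc] using QuotientGroup.eq.1 h
    exact Subtype.ext <| (Subgroup.isComplement_iff_existsUnique_inv_mul_mem.1 hT _).unique hK
      (by simp)
  · obtain ⟨d, rfl⟩ := QuotientGroup.mk_surjective c
    obtain ⟨t, ht, -⟩ := Subgroup.isComplement_iff_existsUnique_inv_mul_mem.1 hT (z * d)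
    refine ⟨⟨t, ?_⟩, QuotientGroup.eq.2 ?_⟩
    · simpa [mul_assoc] using mul_mem d.2 (inv_mem (hKL ht))
    · simpa [Subgroup.mem_subgroupOf, mul_assoc] using ht

namespace ZeroDimGroup

section Translations

variable {G : Type*} [AddCommGroup G] [TopologicalSpace G] {p : ℕ} (S : ZeroDimGroup G p)

theorem zsmul_g_mem_chain_add_one_iff {n c : ℤ} (hc : |c| < p) :
    c • S.g n ∈ S.chain (n + 1) ↔ c = 0 := by
  refine ⟨fun h => ?_, fun h => by simp [h]⟩
  by_contra hc0
  refine S.smul_g_notMem n c.natAbs (Int.natAbs_ne_zero.2 hc0) (by grind) ?_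
  rcases Int.natAbs_eq c with hn | hn
  · rwa [hn, natCast_zsmul] at h
  · rwa [hn, neg_zsmul, neg_mem_iff, natCast_zsmul] at h

theorem eq_zero_of_sum_zsmul_g_mem {F : Finset ℤ} {c : ℤ → ℤ} (hc : ∀ k, |c k| < p) {n : ℤ}
    (hF : ∀ k ∈ F, k < n) (h : ∑ k ∈ F, c k • S.g k ∈ S.chain n) : ∀ k ∈ F, c k = 0 := by
  induction F using Finset.induction_on_min with
  | empty => simp
  | insert m F hm ih =>
    rw [Finset.forall_mem_insert] at hF ⊢
    rw [Finset.sum_insert fun hmF => (hm m hmF).false] at h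
    have hrest : ∑ k ∈ F, c k • S.g k ∈ S.chain (m + 1) :=
      sum_mem fun k hk => zsmul_mem (S.chain_anti (hm k hk) (S.g_mem k)) _
    have hcm : c m = 0 := (S.zsmul_g_mem_chain_add_one_iff (hc m)).1
      ((add_mem_cancel_right hrest).1 (S.chain_anti (by omega) h))
    rw [hcm, zero_zsmul, zero_add] at h
    exact ⟨hcm, ih hF.2 h⟩

theorem exists_mem_H₀_sub_mem [IsTopologicalAddGroup G] (x : G) :
    ∃ h ∈ S.H₀, x - h ∈ S.chain 0 := by
  obtain ⟨m, hm⟩ := S.exists_mem_chain x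
  obtain ⟨a, ha, ha0, hx⟩ := S.exists_expansion m x hm
  set F := Finset.Icc (-(m.natAbs : ℤ)) (-1)
  refine ⟨∑ k ∈ F, a k • S.g k, ⟨m.natAbs, fun k => ⟨a k, ha k⟩, rfl⟩, ?_⟩
  refine (S.isClosed_chain 0).mem_of_tendsto
    ((Finset.hasSum_compl_iff F).2 ((sub_add_cancel x _).symm ▸ hx))
    (Eventually.of_forall fun T => sum_mem fun k _ => ?_)
  by_cases hk : (k : ℤ) < m
  · simp [ha0 k hk]
  · have hkF := k.2
    simp only [F, Finset.mem_Icc] at hkF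
    exact nsmul_mem (S.chain_anti (by omega) (S.g_mem _)) _

theorem exists_eq_sum_of_mem_H₀ {h : G} (hh : h ∈ S.H₀) :
    ∃ s : ℕ, ∀ n ≥ s, ∃ c : ℤ → ℤ, (∀ k, 0 ≤ c k ∧ c k < p) ∧
      h = ∑ k ∈ Finset.Icc (-(n : ℤ)) (-1), c k • S.g k := by
  obtain ⟨s, a, rfl⟩ := hh
  refine ⟨s, fun n hn => ⟨fun k => if -(s : ℤ) ≤ k then (a k : ℕ) else 0, fun k => ?_, ?_⟩⟩
  · have := (a k).2
    dsimp only
    split_ifs <;> omega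
  · simp only [ite_smul, zero_smul, natCast_zsmul]
    rw [← Finset.sum_filter]
    refine Finset.sum_congr ?_ fun _ _ => rfl
    ext k
    simp only [Finset.mem_Icc, Finset.mem_filter]
    omega

theorem eq_of_mem_H₀_of_sub_mem {h h' : G} (hh : h ∈ S.H₀) (hh' : h' ∈ S.H₀)
    (hs : h - h' ∈ S.chain 0) : h = h' := by
  obtain ⟨s, hs'⟩ := S.exists_eq_sum_of_mem_H₀ hh
  obtain ⟨s', hs''⟩ := S.exists_eq_sum_of_mem_H₀ hh'
  obtain ⟨c, hc, rfl⟩ := hs' _ (le_max_left s s')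
  obtain ⟨c', hc', rfl⟩ := hs'' _ (le_max_right s s')
  rw [← Finset.sum_sub_distrib] at hs
  simp only [← sub_smul] at hs
  have hzero := S.eq_zero_of_sum_zsmul_g_mem (c := fun k => c k - c' k)
    (fun k => abs_lt.2 (by have := hc k; have := hc' k; constructor <;> omega))
    (fun k hk => by have := (Finset.mem_Icc.1 hk).2; omega) hs
  exact Finset.sum_congr rfl fun k hk => by rw [sub_eq_zero.1 (hzero k hk)]

theorem isComplement_H₀_chain [IsTopologicalAddGroup G] :
    AddSubgroup.IsComplement S.H₀ (S.chain 0 : Set G) := by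
  refine AddSubgroup.isComplement_iff_existsUnique_neg_add_mem.2 fun x => ?_
  obtain ⟨h, hh, hx⟩ := S.exists_mem_H₀_sub_mem x
  refine ⟨⟨h, hh⟩, by simpa [neg_add_eq_sub] using hx, fun h' hx' => Subtype.ext ?_⟩
  refine S.eq_of_mem_H₀_of_sub_mem h'.2 hh ?_
  have hx'' : x - h' ∈ S.chain 0 := by simpa [neg_add_eq_sub] using hx'
  simpa using sub_mem hx hx''

theorem countable_H₀ : S.H₀.Countable := by
  have hspan : (Submodule.span ℕ (Set.range S.g) : Set G).Countable :=
    (inferInstance : Countable (Submodule.span ℕ (Set.range S.g)))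
  refine hspan.mono ?_
  rintro _ ⟨s, a, rfl⟩
  exact sum_mem fun k _ => Submodule.smul_mem _ _ (Submodule.subset_span ⟨k, rfl⟩)

theorem relIndex_chain_add (n : ℤ) (i : ℕ) :
    (S.chain (n + i)).relIndex (S.chain n) = p ^ i := by
  induction i with
  | zero => simp
  | succ i ih =>
    rw [← AddSubgroup.relIndex_mul_relIndex _ (S.chain (n + i)) _ (S.chain_anti (by omega))
      (S.chain_anti (by omega)), ih, pow_succ', Nat.cast_succ, ← add_assoc, S.relIndex_chain]

theorem card_H₀_inter_coset [IsTopologicalAddGroup G] (s : ℕ) (z : G) :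
    Nat.card {h : S.H₀ // -z + h ∈ S.chain (-(s : ℤ))} = p ^ s := by
  rw [card_addTransversal_inter_leftAddCoset S.isComplement_H₀_chain (S.chain_anti (by omega)),
    ← S.relIndex_chain_add (-(s : ℤ)) s, neg_add_cancel]

end Translations

end ZeroDimGroup

theorem ae_eq_zero_of_setIntegral_eq_zero_of_generateFrom {α E : Type*} [NormedAddCommGroup E]
    [NormedSpace ℝ E] [CompleteSpace E] {mα : MeasurableSpace α} {μ : Measure α}
    {C : Set (Set α)} (hA : mα = MeasurableSpace.generateFrom C) (hC : IsPiSystem C) {f : α → E}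
    (hf : Integrable f μ) (huniv : ∫ x, f x ∂μ = 0) (h : ∀ s ∈ C, ∫ x in s, f x ∂μ = 0) :
    f =ᵐ[μ] 0 := by
  refine hf.ae_eq_of_withDensityᵥ_eq (integrable_zero α E μ) ?_
  rw [withDensityᵥ_zero]
  refine VectorMeasure.ext_of_generateFrom C (fun s hs => ?_) hA hC ?_
  · rw [withDensityᵥ_apply hf (hA ▸ MeasurableSpace.measurableSet_generateFrom hs), h s hs]
    rfl
  · rw [withDensityᵥ_apply hf .univ, setIntegral_univ, huniv]
    rfl

namespace ZeroDimGroup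

section ChainCosets

variable {G : Type*} [AddCommGroup G] [TopologicalSpace G] {p : ℕ} (S : ZeroDimGroup G p)

/-- The family of all cosets `y + Gₖ`, i.e. of all balls of `G`. -/
def chainCosets : Set (Set G) := Set.range fun z : G × ℤ => z.1 +ᵥ (S.chain z.2 : Set G)

theorem vadd_chain_mem_chainCosets (y : G) (k : ℤ) :
    y +ᵥ (S.chain k : Set G) ∈ S.chainCosets :=
  ⟨(y, k), rfl⟩

theorem isPiSystem_chainCosets : IsPiSystem S.chainCosets := by
  rintro _ ⟨⟨y, k⟩, rfl⟩ _ ⟨⟨y', k'⟩, rfl⟩ ⟨x, hx, hx'⟩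
  have eq_of_mem {z : G} {l : ℤ} (h : x ∈ z +ᵥ (S.chain l : Set G)) :
      z +ᵥ (S.chain l : Set G) = x +ᵥ (S.chain l : Set G) :=
    (leftAddCoset_eq_iff _).2 ((mem_leftAddCoset_iff z).1 h)
  refine ⟨(x, max k k'), ?_⟩
  dsimp only at hx hx' ⊢
  rw [eq_of_mem hx, eq_of_mem hx', ← Set.vadd_set_inter]
  rcases le_total k k' with h | h
  · rw [max_eq_right h, Set.inter_eq_right.2 (S.chain_anti h)]
  · rw [max_eq_left h, Set.inter_eq_left.2 (S.chain_anti h)]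

variable [IsTopologicalAddGroup G]

theorem exists_mem_H₀_sub_dilPow_mem (k : ℤ) (y : G) :
    ∃ h ∈ S.H₀, y - S.dilPow (-k) h ∈ S.chain k := by
  obtain ⟨h, hh, hy⟩ := S.exists_mem_H₀_sub_mem (S.dilPow k y)
  refine ⟨h, hh, ?_⟩
  rwa [← zero_add k, ← S.dilPow_mem_iff, zero_add, map_sub, S.dilPow_dilPow_neg]

theorem countable_chainCosets : S.chainCosets.Countable := by
  have := S.countable_H₀.to_subtype
  refine (Set.countable_range fun z : S.H₀ × ℤ =>
    S.dilPow (-z.2) z.1 +ᵥ (S.chain z.2 : Set G)).mono ?_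
  rintro _ ⟨⟨y, k⟩, rfl⟩
  obtain ⟨h, hh, hy⟩ := S.exists_mem_H₀_sub_dilPow_mem k y
  exact ⟨(⟨h, hh⟩, k), (leftAddCoset_eq_iff _).2 (by rwa [neg_add_eq_sub])⟩

theorem isTopologicalBasis_chainCosets :
    TopologicalSpace.IsTopologicalBasis S.chainCosets := by
  refine TopologicalSpace.isTopologicalBasis_of_isOpen_of_nhds ?_ fun y U hy hU => ?_
  · rintro _ ⟨⟨y, k⟩, rfl⟩
    exact (S.isOpen_chain k).vadd y
  · obtain ⟨k, hk⟩ := S.exists_chain_subset (-y +ᵥ U)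
      ((hU.vadd (-y)).mem_nhds ⟨y, hy, neg_add_cancel y⟩)
    exact ⟨_, S.vadd_chain_mem_chainCosets y k, mem_own_leftAddCoset _ y,
      Set.vadd_set_subset_iff_subset_neg_vadd_set.2 hk⟩

variable [mG : MeasurableSpace G] [BorelSpace G]

theorem generateFrom_chainCosets : mG = MeasurableSpace.generateFrom S.chainCosets := by
  have := S.isTopologicalBasis_chainCosets.secondCountableTopology S.countable_chainCosets
  rw [BorelSpace.measurable_eq (α := G), S.isTopologicalBasis_chainCosets.borel_eq_generateFrom]

theorem ae_eq_zero_of_setIntegral_chainCosets {E : Type*} [NormedAddCommGroup E]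
    [NormedSpace ℝ E] [CompleteSpace E] {μ : Measure G} {f : G → E}
    (hf : ∀ s ∈ S.chainCosets, IntegrableOn f s μ)
    (h0 : ∀ s ∈ S.chainCosets, ∫ x in s, f x ∂μ = 0) : f =ᵐ[μ] 0 := by
  have hchain (n : ℤ) : (S.chain n : Set G) ∈ S.chainCosets := ⟨(0, n), zero_vadd _ _⟩
  have hae (n : ℤ) : f =ᵐ[μ.restrict (S.chain n : Set G)] 0 := by
    refine ae_eq_zero_of_setIntegral_eq_zero_of_generateFrom S.generateFrom_chainCosets
      S.isPiSystem_chainCosets (hf _ (hchain n)) (h0 _ (hchain n)) fun s hs => ?_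
    have hsm := (S.isTopologicalBasis_chainCosets.isOpen hs).measurableSet
    rw [Measure.restrict_restrict hsm]
    rcases (s ∩ (S.chain n : Set G)).eq_empty_or_nonempty with he | hne
    · rw [he, setIntegral_empty]
    · exact h0 _ (S.isPiSystem_chainCosets _ hs _ (hchain n) hne)
  have hcover : ⋃ n, (S.chain n : Set G) = Set.univ :=
    Set.eq_univ_of_forall fun x => Set.mem_iUnion.2 (S.exists_mem_chain x)
  have := (ae_restrict_iUnion_iff (fun n => (S.chain n : Set G)) (f · = 0)).2 hae
  rwa [hcover, Measure.restrict_univ] at this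

end ChainCosets

section Averages

variable {G : Type*} [AddCommGroup G] [TopologicalSpace G] [IsTopologicalAddGroup G] {p : ℕ}
  (S : ZeroDimGroup G p) [MeasurableSpace G] [BorelSpace G] (μ : Measure G)
  [μ.IsAddLeftInvariant] (hμ : μ (S.chain 0 : Set G) = 1)

theorem inner_packetLp_one (k : ℤ) (y : G) (f : Lp ℂ 2 μ) :
    inner ℂ (S.packetLp μ hμ 1 k y) f = halfZPow p k * ∫ x in y +ᵥ (S.chain k : Set G), f x ∂μ := by
  have hmeas : MeasurableSet (y +ᵥ (S.chain k : Set G)) :=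
    (S.isOpen_chain k).measurableSet.const_vadd y
  have hpacket (x : G) : f x * conj (S.packet 1 k y x) =
      halfZPow p k * (y +ᵥ (S.chain k : Set G)).indicator f x := by
    have hmem : x ∈ y +ᵥ (S.chain k : Set G) ↔ x - y ∈ (S.chain k : Set G) := by
      rw [Set.mem_vadd_set_iff_neg_vadd_mem, vadd_eq_add, neg_add_eq_sub]
    by_cases hx : x - y ∈ (S.chain k : Set G)
    · rw [packet, Set.indicator_of_mem hx, Set.indicator_of_mem (hmem.2 hx), charVal_one, mul_one,
        conj_halfZPow, mul_comm]
    · rw [packet, Set.indicator_of_notMem hx, Set.indicator_of_notMem (mt hmem.1 hx), mul_zero,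
        map_zero, mul_zero]
  rw [packetLp, inner_toLp_left, ← integral_indicator hmeas, ← integral_const_mul]
  exact integral_congr_ae (.of_forall hpacket)

theorem eq_zero_of_inner_packetLp_one {f : Lp ℂ 2 μ}
    (h : ∀ k y, inner ℂ (S.packetLp μ hμ 1 k y) f = 0) : f = 0 := by
  refine (Lp.eq_zero_iff_ae_eq_zero).2 (S.ae_eq_zero_of_setIntegral_chainCosets ?_ ?_)
  · rintro _ ⟨⟨y, k⟩, rfl⟩
    have hfin : μ (y +ᵥ (S.chain k : Set G)) ≠ ∞ := by
      rw [measure_vadd]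
      exact S.measure_chain_ne_top μ hμ k
    exact integrableOn_Lp_of_measure_ne_top f one_le_two hfin
  · rintro _ ⟨⟨y, k⟩, rfl⟩
    have := h k y
    rw [inner_packetLp_one] at this
    exact (mul_eq_zero.1 this).resolve_left (halfZPow_ne_zero S.prime.ne_zero k)

theorem tendsto_halfZPow_mul_inner_packetLp (y : G) (f : Lp ℂ 2 μ) :
    Tendsto (fun n => halfZPow p n * inner ℂ (S.packetLp μ hμ 1 n y) f) atBot (𝓝 0) := by
  have hbound : Tendsto (fun n => ‖halfZPow p n‖ * ‖f‖) atBot (𝓝 0) := by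
    simpa only [norm_zero, zero_mul] using
      (tendsto_halfZPow_atBot S.prime.one_lt).norm.mul_const ‖f‖
  refine squeeze_zero_norm (fun n => ?_) hbound
  have := norm_inner_le_norm (𝕜 := ℂ) (S.packetLp μ hμ 1 n y) f
  rw [norm_packetLp, one_mul] at this
  rw [norm_mul]
  gcongr

end Averages

section Totality

variable {G : Type*} [AddCommGroup G] [TopologicalSpace G] {p : ℕ} (S : ZeroDimGroup G p)
  [MeasurableSpace (CharGroup G)] [BorelSpace (CharGroup G)] (ν : Measure (CharGroup G))
  [ν.IsMulLeftInvariant] (hν : ν (S.ann 0) = 1)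

include hν in
theorem integrableOn_charVal_smul_ann (ρ : CharGroup G) (k : ℤ) (x : G) :
    IntegrableOn (charVal · x) (ρ • S.ann k) ν :=
  .of_bound ((measure_smul ν ρ _).trans_lt (S.measure_ann_ne_top ν hν k).lt_top)
    (continuous_charVal_left x).aestronglyMeasurable 1 (.of_forall fun χ => (norm_charVal χ x).le)

include ν hν in
theorem sum_packet {ι : Type*} [Fintype ι] {ρ : ι → CharGroup G} {k : ι → ℤ}
    (hd : Pairwise fun i j => Disjoint (ρ i • S.ann (k i)) (ρ j • S.ann (k j))) {m n : ℤ}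
    (hmn : m ≤ n) (hU : ⋃ i, ρ i • S.ann (k i) = S.ann n \ S.ann m) (y : G) :
    ∑ i, halfZPow p (k i) • S.packet (ρ i) (k i) y =
      halfZPow p n • S.packet 1 n y - halfZPow p m • S.packet 1 m y := by
  have packet_eq (ρ : CharGroup G) (k : ℤ) (x : G) :
      halfZPow p k * S.packet ρ k y x = ∫ χ in ρ • S.ann k, charVal χ (x - y) ∂ν := by
    rw [← integral_indicator (S.measurableSet_smul_ann ρ k), ← invFourierTr_indicator_one,
      S.invFourierTr_indicator_smul_ann_eq_packet ν hν]
    simp only [packet, Pi.smul_apply, smul_eq_mul, sub_zero]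
  have hmeas (k : ℤ) : MeasurableSet (S.ann k) := by
    simpa only [one_smul] using S.measurableSet_smul_ann 1 k
  have hint (k : ℤ) (x : G) : IntegrableOn (charVal · x) (S.ann k) ν := by
    simpa only [one_smul] using S.integrableOn_charVal_smul_ann ν hν 1 k x
  funext x
  simp only [Finset.sum_apply, Pi.sub_apply, Pi.smul_apply, smul_eq_mul, packet_eq, one_smul]
  rw [← integral_iUnion_fintype (fun i => S.measurableSet_smul_ann _ _) hd
      (fun i => S.integrableOn_charVal_smul_ann ν hν _ _ _), hU,
    setIntegral_sdiff (hmeas m) (hint n _) (S.ann_mono hmn)]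

variable [IsTopologicalAddGroup G] [MeasurableSpace G] [BorelSpace G]
  (μ : Measure G) [μ.IsAddLeftInvariant] (hμ : μ (S.chain 0 : Set G) = 1)

include ν hν in
theorem sum_packetLp {ι : Type*} [Fintype ι] {ρ : ι → CharGroup G} {k : ι → ℤ}
    (hd : Pairwise fun i j => Disjoint (ρ i • S.ann (k i)) (ρ j • S.ann (k j))) {m n : ℤ}
    (hmn : m ≤ n) (hU : ⋃ i, ρ i • S.ann (k i) = S.ann n \ S.ann m) (y : G) :
    ∑ i, halfZPow p (k i) • S.packetLp μ hμ (ρ i) (k i) y =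
      halfZPow p n • S.packetLp μ hμ 1 n y - halfZPow p m • S.packetLp μ hμ 1 m y := by
  simp only [packetLp, ← MemLp.toLp_const_smul, ← MemLp.toLp_sub]
  refine Lp.ext ((Lp.coeFn_fun_finsetSum _ _).trans ?_)
  have hcoe := ae_all_iff.2 fun i =>
    ((S.memLp_packet μ hμ (ρ i) (k i) y).const_smul (halfZPow p (k i))).coeFn_toLp
  filter_upwards [hcoe, (((S.memLp_packet μ hμ 1 n y).const_smul (halfZPow p n)).sub
    ((S.memLp_packet μ hμ 1 m y).const_smul (halfZPow p m))).coeFn_toLp] with x hx hx'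
  rw [hx', ← S.sum_packet ν hν hd hmn hU y, Finset.sum_apply]
  exact Finset.sum_congr rfl fun i _ => hx i

include ν hν in
theorem eq_zero_of_inner_packetLp_eq_zero {ι : Type*} [Finite ι] {ρ : ℤ → ι → CharGroup G}
    {k : ℤ → ι → ℤ}
    (hd : ∀ n, Pairwise fun i j => Disjoint (ρ n i • S.ann (k n i)) (ρ n j • S.ann (k n j)))
    (hU : ∀ n, ⋃ i, ρ n i • S.ann (k n i) = S.ann (n + 1) \ S.ann n) {f : Lp ℂ 2 μ}
    (h : ∀ n i y, inner ℂ (S.packetLp μ hμ (ρ n i) (k n i) y) f = 0) : f = 0 := by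
  have := Fintype.ofFinite ι
  refine S.eq_zero_of_inner_packetLp_one μ hμ fun n y => ?_
  let u : ℤ → ℂ := fun n => halfZPow p n * inner ℂ (S.packetLp μ hμ 1 n y) f
  have hperiodic : Function.Periodic u 1 := fun n => by
    have hsum := congrArg (inner ℂ · f)
      (S.sum_packetLp ν hν μ hμ (hd n) (Int.le_add_one le_rfl) (hU n) y)
    simp only [sum_inner, inner_sub_left, inner_smul_left, conj_halfZPow, h, mul_zero,
      Finset.sum_const_zero] at hsum
    exact sub_eq_zero.1 hsum.symm
  have hconst (m : ℤ) : u m = u n := by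
    rw [← mul_one m, ← mul_one n]
    exact (hperiodic.int_mul_eq m).trans (hperiodic.int_mul_eq n).symm
  have hzero : u n = 0 :=
    tendsto_nhds_unique (tendsto_const_nhds.congr fun m => (hconst m).symm)
      (S.tendsto_halfZPow_mul_inner_packetLp μ hμ y f)
  exact (mul_eq_zero.1 hzero).resolve_left (halfZPow_ne_zero S.prime.ne_zero n)

end Totality

end ZeroDimGroup

section Frames

variable {ι κ H : Type*} [NormedAddCommGroup H] [InnerProductSpace ℂ H]

theorem re_inner_sum_inner_smul (u : ι → H) (f : H) (T : Finset ι) :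
    RCLike.re (inner ℂ (∑ i ∈ T, inner ℂ (u i) f • u i) f) = ∑ i ∈ T, ‖inner ℂ (u i) f‖ ^ 2 := by
  rw [sum_inner, map_sum]
  refine Finset.sum_congr rfl fun i _ => ?_
  rw [inner_smul_left, RCLike.conj_mul, ← RCLike.ofReal_pow, RCLike.ofReal_re]

theorem norm_sq_sum_inner_smul_le {u : ι → H}
    (hu : ∀ f, HasSum (fun i => ‖inner ℂ (u i) f‖ ^ 2) (‖f‖ ^ 2)) (f : H) (T : Finset ι) :
    ‖∑ i ∈ T, inner ℂ (u i) f • u i‖ ^ 2 ≤ ∑ i ∈ T, ‖inner ℂ (u i) f‖ ^ 2 := by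
  set w := ∑ i ∈ T, inner ℂ (u i) f • u i
  have hbessel : ∑ i ∈ T, ‖inner ℂ (u i) w‖ ^ 2 ≤ ‖w‖ ^ 2 :=
    sum_le_hasSum T (fun i _ => sq_nonneg _) (hu w)
  have hself : ‖w‖ ^ 2 ≤ ∑ i ∈ T, ‖inner ℂ (u i) f‖ * ‖inner ℂ (u i) w‖ := by
    calc ‖w‖ ^ 2 = ‖inner ℂ w w‖ := by rw [inner_self_eq_norm_sq_to_K, norm_pow,
        RCLike.norm_ofReal, abs_norm]
      _ = ‖∑ i ∈ T, inner ℂ (inner ℂ (u i) f • u i) w‖ := by rw [← sum_inner]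
      _ ≤ ∑ i ∈ T, ‖inner ℂ (u i) f‖ * ‖inner ℂ (u i) w‖ :=
        norm_sum_le_of_le _ fun i _ => by rw [inner_smul_left, norm_mul, RCLike.norm_conj]
  have hamgm : 2 * ∑ i ∈ T, ‖inner ℂ (u i) f‖ * ‖inner ℂ (u i) w‖ ≤
      ∑ i ∈ T, ‖inner ℂ (u i) f‖ ^ 2 + ∑ i ∈ T, ‖inner ℂ (u i) w‖ ^ 2 := by
    rw [Finset.mul_sum, ← Finset.sum_add_distrib]
    exact Finset.sum_le_sum fun i _ => by
      simpa only [mul_assoc] using two_mul_le_add_sq ‖inner ℂ (u i) f‖ ‖inner ℂ (u i) w‖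
  linarith

theorem isParsevalFrame_of_hasSum_norm_sq {u : ι → H}
    (hu : ∀ f, HasSum (fun i => ‖inner ℂ (u i) f‖ ^ 2) (‖f‖ ^ 2)) : IsParsevalFrame u := by
  refine fun f => ⟨hu f, ?_⟩
  have hle (T : Finset ι) : ‖∑ i ∈ T, inner ℂ (u i) f • u i - f‖ ^ 2 ≤
      ‖f‖ ^ 2 - ∑ i ∈ T, ‖inner ℂ (u i) f‖ ^ 2 := by
    rw [norm_sub_sq (𝕜 := ℂ), re_inner_sum_inner_smul]
    linarith [norm_sq_sum_inner_smul_le hu f T]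
  have hlim : Tendsto (fun T : Finset ι => ‖f‖ ^ 2 - ∑ i ∈ T, ‖inner ℂ (u i) f‖ ^ 2) atTop
      (𝓝 0) := by
    have := hu f
    rw [HasSum, SummationFilter.unconditional_filter] at this
    rw [← sub_self (‖f‖ ^ 2)]
    exact this.const_sub _
  have hsq := (squeeze_zero (fun T => sq_nonneg _) hle hlim).sqrt
  simp only [Real.sqrt_sq (norm_nonneg _), Real.sqrt_zero] at hsq
  rw [HasSum, SummationFilter.unconditional_filter]
  exact tendsto_iff_norm_sub_tendsto_zero.2 hsq

theorem hasSum_norm_sq_inner_hilbertBasis (b : HilbertBasis ι ℂ H) (f : H) :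
    HasSum (fun i => ‖inner ℂ (b i) f‖ ^ 2) (‖f‖ ^ 2) := by
  simpa only [ENNReal.toReal_ofNat, Real.rpow_ofNat, LinearIsometryEquiv.norm_map,
    b.repr_apply_apply] using lp.hasSum_norm (p := 2) (by norm_num) (b.repr f)

theorem isParsevalFrame_smul_hilbertBasis (b : HilbertBasis ι ℂ H) (π : κ → ι) {c : κ → ℂ}
    (hc : ∀ i, HasSum (fun k : {k // π k = i} => ‖c k‖ ^ 2) 1) :
    IsParsevalFrame fun k => c k • b (π k) := by
  refine isParsevalFrame_of_hasSum_norm_sq fun f => (Equiv.sigmaFiberEquiv π).hasSum_iff.1 ?_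
  have hfib (i : ι) : HasSum (fun k : {k // π k = i} => ‖inner ℂ (c k • b (π k)) f‖ ^ 2)
      (‖inner ℂ (b i) f‖ ^ 2) := by
    have hnorm (k : {k // π k = i}) :
        ‖inner ℂ (c k • b (π k)) f‖ ^ 2 = ‖c k‖ ^ 2 * ‖inner ℂ (b i) f‖ ^ 2 := by
      rw [k.2, inner_smul_left, norm_mul, mul_pow, RCLike.norm_conj]
    simpa only [hnorm, one_mul] using (hc i).mul_right (‖inner ℂ (b i) f‖ ^ 2)
  have hb := hasSum_norm_sq_inner_hilbertBasis b f
  exact hb.sigma_of_hasSum hfib <| (summable_sigma_of_nonneg fun _ => sq_nonneg _).2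
    ⟨fun i => (hfib i).summable, hb.summable.congr fun i => (hfib i).tsum_eq.symm⟩

theorem IsParsevalFrame.comp_equiv {u : ι → H} (hu : IsParsevalFrame u) (e : κ ≃ ι) :
    IsParsevalFrame (u ∘ e) :=
  fun f => ⟨e.hasSum_iff.2 (hu f).1, e.hasSum_iff.2 (hu f).2⟩

end Frames

namespace ZeroDimGroup

section Partition

variable {G : Type*} [AddCommGroup G] [TopologicalSpace G] {p : ℕ} (S : ZeroDimGroup G p)

theorem pairwise_disjoint_ann_sdiff :
    Pairwise fun m n => Disjoint (S.ann (m + 1) \ S.ann m) (S.ann (n + 1) \ S.ann n) := by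
  suffices h : ∀ m n, m < n → Disjoint (S.ann (m + 1) \ S.ann m) (S.ann (n + 1) \ S.ann n) from
    fun m n hne => hne.lt_or_gt.elim (h m n) fun hlt => (h n m hlt).symm
  exact fun m n hlt => Set.disjoint_left.2 fun χ hm hn => hn.2 (S.ann_mono hlt hm.1)

variable [IsTopologicalAddGroup G] {J : Type*} {E : J → Set (CharGroup G)} {t : J → ℤ} {M : ℤ}

theorem iUnion_image_charDil
    (ht : ⋃ j, S.charDil (t j) '' E j = S.ann (M + 1) \ S.ann M) (n : ℤ) :
    ⋃ j, S.charDil (n - M + t j) '' E j = S.ann (n + 1) \ S.ann n := by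
  simp only [← S.image_charDil_image_charDil, ← Set.image_iUnion, ht]
  rw [Set.image_sdiff (S.charDil_injective _), S.image_charDil_ann, S.image_charDil_ann]
  congr 2 <;> ring

theorem pairwise_disjoint_image_charDil
    (htd : Pairwise fun i j => Disjoint (S.charDil (t i) '' E i) (S.charDil (t j) '' E j))
    (ht : ⋃ j, S.charDil (t j) '' E j = S.ann (M + 1) \ S.ann M) :
    Pairwise fun i j : J × ℤ => Disjoint (S.charDil i.2 '' E i.1) (S.charDil j.2 '' E j.1) := by
  have hsub (j : J) (n : ℤ) : S.charDil n '' E j ⊆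
      S.ann (M + (n - t j) + 1) \ S.ann (M + (n - t j)) := by
    rw [← S.iUnion_image_charDil ht]
    convert Set.subset_iUnion (fun i => S.charDil (M + (n - t j) - M + t i) '' E i) j using 3
    ring
  rintro ⟨i, m⟩ ⟨j, n⟩ hne
  dsimp only
  by_cases hmn : m - t i = n - t j
  · have hij : i ≠ j := fun hij => hne (by subst hij; exact congrArg _ (sub_left_injective hmn))
    have hm : m = m - t i + t i := (sub_add_cancel _ _).symm
    have hn : n = m - t i + t j := by rw [hmn, sub_add_cancel]
    rw [hn]
    nth_rw 1 [hm]
    rw [← S.image_charDil_image_charDil, ← S.image_charDil_image_charDil]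
    exact (Set.disjoint_image_iff (S.charDil_injective _)).2 (htd hij)
  · exact (S.pairwise_disjoint_ann_sdiff (mt add_left_cancel hmn)).mono (hsub i m) (hsub j n)

end Partition

end ZeroDimGroup

theorem hasSum_const_of_card_mul {α : Type*} {a : ℝ} (h : Nat.card α * a = 1) :
    HasSum (fun _ : α => a) 1 := by
  have : Finite α := Nat.finite_of_card_ne_zero fun h0 => by simp [h0] at h
  rw [Summable.of_finite.hasSum_iff, tsum_const, nsmul_eq_mul, h]

theorem card_fiber_prodMk {α β γ : Type*} (r : α → β → γ) (a : α) (c : γ) :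
    Nat.card {i : α × β // (i.1, r i.1 i.2) = (a, c)} = Nat.card {x // r a x = c} := by
  refine (Nat.card_congr (.ofBijective
    (fun x => ⟨(a, x), congrArg (Prod.mk a) x.2⟩) ⟨fun x y h => ?_, ?_⟩)).symm
  · simpa [Subtype.ext_iff] using h
  · rintro ⟨⟨a', x⟩, hi⟩
    obtain ⟨rfl, hx⟩ := Prod.mk.inj hi
    exact ⟨⟨x, hx⟩, rfl⟩

namespace ZeroDimGroup

section PacketSystem

variable {G : Type*} [AddCommGroup G] [TopologicalSpace G] [IsTopologicalAddGroup G] {p : ℕ}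
  (S : ZeroDimGroup G p)

theorem card_H₀_dilPow_sub_mem (s : ℕ) (n : ℤ) (y : G) :
    Nat.card {h : S.H₀ // S.dilPow (-n) h - y ∈ S.chain (-(s : ℤ) + n)} = p ^ s := by
  rw [← S.card_H₀_inter_coset s (S.dilPow n y)]
  refine Nat.card_congr (Equiv.subtypeEquivRight fun h => ?_)
  rw [← S.dilPow_mem_iff, map_sub, S.dilPow_dilPow_neg, neg_add_eq_sub]

theorem eq_of_dilPow_sub_dilPow_mem {k : ℤ} {h h' : S.H₀}
    (hs : S.dilPow (-k) h - S.dilPow (-k) h' ∈ S.chain k) : h = h' := by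
  refine Subtype.ext (S.eq_of_mem_H₀_of_sub_mem h.2 h'.2 ?_)
  rwa [← map_sub, S.dilPow_mem_iff, add_neg_cancel] at hs

theorem card_fiber_H₀ {s : ℕ} {n : ℤ} {r : S.H₀ → S.H₀}
    (hr : ∀ h : S.H₀, S.dilPow (-n) h - S.dilPow (-(-(s : ℤ) + n)) (r h) ∈ S.chain (-(s : ℤ) + n))
    (h' : S.H₀) : Nat.card {h // r h = h'} = p ^ s := by
  rw [← S.card_H₀_dilPow_sub_mem s n (S.dilPow (-(-(s : ℤ) + n)) h')]
  refine Nat.card_congr (Equiv.subtypeEquivRight fun h => ⟨?_, fun hs => ?_⟩)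
  · rintro rfl
    exact hr h
  · refine S.eq_of_dilPow_sub_dilPow_mem (k := -(s : ℤ) + n) ?_
    rw [← sub_sub_sub_cancel_left _ _ (S.dilPow (-n) h)]
    exact sub_mem hs (hr h)

variable [MeasurableSpace G] [BorelSpace G] (μ : Measure G) [μ.IsAddLeftInvariant]
  (hμ : μ (S.chain 0 : Set G) = 1) {Λ : Type*} {ρ : Λ → CharGroup G} {k : Λ → ℤ}

/-- The wave packets with frequencies in the cosets `ρ l • S.ann (k l)`, one for each coset of
`S.chain (k l)`; these cosets are represented by `𝒜⁻ᵏ h` with `h ∈ H₀`. -/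
noncomputable def packetSystem (ρ : Λ → CharGroup G) (k : Λ → ℤ) (i : Λ × S.H₀) : Lp ℂ 2 μ :=
  S.packetLp μ hμ (ρ i.1) (k i.1) (S.dilPow (-k i.1) i.2)

theorem orthonormal_packetSystem
    (hd : Pairwise fun i j => Disjoint (ρ i • S.ann (k i)) (ρ j • S.ann (k j))) :
    Orthonormal ℂ (S.packetSystem μ hμ ρ k) := by
  refine ⟨fun i => S.norm_packetLp μ hμ _ _ _, ?_⟩
  rintro ⟨l, h⟩ ⟨l', h'⟩ hne
  by_cases hl : l = l'
  · subst hl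
    refine S.inner_packetLp_of_sub_notMem μ hμ _ fun hs => hne ?_
    exact congrArg _ (S.eq_of_dilPow_sub_dilPow_mem hs)
  · exact S.inner_packetLp_of_disjoint μ hμ (hd hl) _ _

theorem inner_packetLp_eq_zero {f : Lp ℂ 2 μ} (l : Λ)
    (h : ∀ i, inner ℂ (S.packetSystem μ hμ ρ k (l, i)) f = 0) (y : G) :
    inner ℂ (S.packetLp μ hμ (ρ l) (k l) y) f = 0 := by
  obtain ⟨i, hi, hs⟩ := S.exists_mem_H₀_sub_dilPow_mem (k l) y
  rw [← neg_mem_iff, neg_sub] at hs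
  rw [S.packetLp_eq_charVal_smul μ hμ (ρ l) hs, inner_smul_left]
  exact mul_eq_zero_of_right _ (h ⟨i, hi⟩)

theorem isParsevalFrame_packetLp {s : Λ → ℕ} {n : Λ → ℤ}
    (b : HilbertBasis (Λ × S.H₀) ℂ (Lp ℂ 2 μ))
    (hb : ⇑b = S.packetSystem μ hμ ρ fun l => -(s l : ℤ) + n l) :
    IsParsevalFrame fun i : Λ × S.H₀ => halfZPow p (-(s i.1 : ℤ)) •
      S.packetLp μ hμ (ρ i.1) (-(s i.1 : ℤ) + n i.1) (S.dilPow (-n i.1) i.2) := by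
  set k : Λ → ℤ := fun l => -(s l : ℤ) + n l
  have hrepr (l : Λ) (h : S.H₀) :
      ∃ h' : S.H₀, S.dilPow (-n l) h - S.dilPow (-k l) h' ∈ S.chain (k l) := by
    simpa using S.exists_mem_H₀_sub_dilPow_mem (k l) (S.dilPow (-n l) h)
  choose r hr using hrepr
  let π (i : Λ × S.H₀) : Λ × S.H₀ := (i.1, r i.1 i.2)
  let c (i : Λ × S.H₀) : ℂ := halfZPow p (-(s i.1 : ℤ)) *
    charVal (ρ i.1) (S.dilPow (-k i.1) (r i.1 i.2) - S.dilPow (-n i.1) i.2)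
  have hc (i : Λ × S.H₀) : ‖c i‖ ^ 2 = (p : ℝ) ^ (-(s i.1 : ℤ)) := by
    rw [norm_mul, norm_charVal, mul_one, norm_halfZPow_sq S.prime.ne_zero]
  have hfiber (l : Λ) (h' : S.H₀) : Nat.card {i // π i = (l, h')} = p ^ s l := by
    rw [← S.card_fiber_H₀ (hr l) h']
    exact card_fiber_prodMk r l h'
  have hframe : IsParsevalFrame fun i => c i • b (π i) := by
    refine isParsevalFrame_smul_hilbertBasis b π fun ⟨l, h'⟩ => ?_
    have hconst (i : {i // π i = (l, h')}) : ‖c i‖ ^ 2 = (p : ℝ) ^ (-(s l : ℤ)) := by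
      rw [hc, (Prod.mk.inj i.2).1]
    simp only [hconst]
    refine hasSum_const_of_card_mul ?_
    rw [hfiber, Nat.cast_pow, ← zpow_natCast, zpow_neg]
    exact mul_inv_cancel₀ (zpow_ne_zero _ (Nat.cast_ne_zero.2 S.prime.ne_zero))
  convert hframe using 2 with i
  rw [hb, mul_smul]
  congr 1
  exact S.packetLp_eq_charVal_smul μ hμ _ (by simpa only [neg_sub] using neg_mem (hr i.1 i.2))

variable [MeasurableSpace (CharGroup G)] [BorelSpace (CharGroup G)] {ν : Measure (CharGroup G)}
  [ν.IsMulLeftInvariant] (hν : ν (S.ann 0) = 1)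

include hν in
theorem exists_hilbertBasis_packetSystem {ι : Type*} [Finite ι]
    (hd : Pairwise fun i j => Disjoint (ρ i • S.ann (k i)) (ρ j • S.ann (k j)))
    {σ : ℤ → ι → Λ} (hσ : ∀ n, Function.Injective (σ n))
    (hU : ∀ n, ⋃ i, ρ (σ n i) • S.ann (k (σ n i)) = S.ann (n + 1) \ S.ann n) :
    ∃ b : HilbertBasis (Λ × S.H₀) ℂ (Lp ℂ 2 μ), ⇑b = S.packetSystem μ hμ ρ k := by
  refine ⟨.mkOfOrthogonalEqBot (S.orthonormal_packetSystem μ hμ hd) ?_,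
    HilbertBasis.coe_mkOfOrthogonalEqBot _ _⟩
  refine (Submodule.eq_bot_iff _).2 fun f hf => ?_
  have hzero (l : Λ) : ∀ y, inner ℂ (S.packetLp μ hμ (ρ l) (k l) y) f = 0 :=
    S.inner_packetLp_eq_zero μ hμ l fun i => hf _ (Submodule.subset_span ⟨(l, i), rfl⟩)
  exact S.eq_zero_of_inner_packetLp_eq_zero ν hν μ hμ (fun n => hd.comp_of_injective (hσ n)) hU
    fun n i => hzero (σ n i)

end PacketSystem

section Wavelets

variable {G : Type*} [AddCommGroup G] [TopologicalSpace G] [IsTopologicalAddGroup G] {p : ℕ}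
  (S : ZeroDimGroup G p) [MeasurableSpace (CharGroup G)] [BorelSpace (CharGroup G)]
  (ν : Measure (CharGroup G)) [ν.IsMulLeftInvariant] (hν : ν (S.ann 0) = 1)

include hν in
theorem affine_invFourierTr_indicator_smul_ann (ρ : CharGroup G) (k n : ℤ) (h : G) :
    S.affine (invFourierTr ν ((ρ • S.ann k).indicator 1)) n h =
      halfZPow p k • S.packet (S.charDil n ρ) (k + n) (S.dilPow (-n) h) := by
  rw [S.invFourierTr_indicator_smul_ann_eq_packet ν hν, S.affine_smul, S.affine_packet]

end Wavelets

end ZeroDimGroup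

theorem theorem3p1_general {G : Type*} [AddCommGroup G] [TopologicalSpace G]
    [IsTopologicalAddGroup G] [MeasurableSpace G] [BorelSpace G]
    [MeasurableSpace (CharGroup G)] [BorelSpace (CharGroup G)]
    {p : ℕ} (S : ZeroDimGroup G p)
    (μ : Measure G) [μ.IsAddLeftInvariant] (hμ : μ (S.chain 0 : Set G) = 1)
    (ν : Measure (CharGroup G)) [ν.IsMulLeftInvariant] (hν : ν (S.ann 0) = 1)
    {J : Type*} [Finite J] (ρ : J → CharGroup G) (s : J → ℕ) (t : J → ℤ) (M : ℤ)
    (htd : Pairwise fun i j => Disjoint (S.charDil (t i) '' (ρ i • S.ann (-(s i : ℤ))))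
      (S.charDil (t j) '' (ρ j • S.ann (-(s j : ℤ)))))
    (ht : ⋃ j, S.charDil (t j) '' (ρ j • S.ann (-(s j : ℤ))) = S.ann (M + 1) \ S.ann M)
    (ψ : J → G → ℂ)
    (hψ : ∀ j, ψ j = invFourierTr ν ((ρ j • S.ann (-(s j : ℤ))).indicator 1)) :
    ∃ hL : ∀ i : J × ℤ × S.H₀, MemLp (S.affine (ψ i.1) i.2.1 (i.2.2 : G)) 2 μ,
      IsParsevalFrame (fun i => (hL i).toLp) := by
  have hd := S.pairwise_disjoint_image_charDil htd ht
  have hU := S.iUnion_image_charDil ht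
  simp only [S.image_charDil_smul_ann] at hd hU
  have haff (i : J × ℤ × S.H₀) : S.affine (ψ i.1) i.2.1 i.2.2 = halfZPow p (-(s i.1 : ℤ)) •
      S.packet (S.charDil i.2.1 (ρ i.1)) (-(s i.1 : ℤ) + i.2.1) (S.dilPow (-i.2.1) i.2.2) := by
    rw [hψ, S.affine_invFourierTr_indicator_smul_ann ν hν]
  have hmem (i : J × ℤ × S.H₀) := (S.memLp_packet μ hμ (S.charDil i.2.1 (ρ i.1))
    (-(s i.1 : ℤ) + i.2.1) (S.dilPow (-i.2.1) i.2.2)).const_smul (halfZPow p (-(s i.1 : ℤ)))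
  refine ⟨fun i => haff i ▸ hmem i, ?_⟩
  obtain ⟨b, hb⟩ := S.exists_hilbertBasis_packetSystem μ hμ hν hd
    (σ := fun n j => (j, n - M + t j)) (fun _ _ _ h => congrArg Prod.fst h) hU
  convert (S.isParsevalFrame_packetLp μ hμ b hb).comp_equiv (Equiv.prodAssoc J ℤ S.H₀).symm using 2
    with i
  exact MemLp.toLp_congr _ (hmem i) (.of_eq (haff i))

end

theorem theorem3p1 {G : Type*} [AddCommGroup G] [TopologicalSpace G] [IsTopologicalAddGroup G]
    [LocallyCompactSpace G] [MeasurableSpace G] [BorelSpace G]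
    [MeasurableSpace (CharGroup G)] [BorelSpace (CharGroup G)]
    {p : ℕ} (S : ZeroDimGroup G p)
    (μ : Measure G) [μ.IsAddHaarMeasure] (hμ : μ (S.chain 0 : Set G) = 1)
    (ν : Measure (CharGroup G)) [ν.IsHaarMeasure] (hν : ν (S.ann 0) = 1)
    (M N : ℕ) (φ : G → ℂ) (hφ : S.IsStep M N φ)
    (m₀ : CharGroup G → ℂ) (hφm₀ : S.IsRefinable ν φ m₀)
    (q : ℕ) (m : Fin q → CharGroup G → ℂ)
    (s : Fin q → ℕ) (α : Fin q → ℤ → Fin p)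
    (hm : ∀ j χ, fourierTr μ φ (S.charDil (-1) χ) * m j χ =
      (S.coset (s j) M (α j)).indicator 1 χ)
    (hE : Pairwise fun i j => Disjoint (S.coset (s i) M (α i)) (S.coset (s j) M (α j)))
    (hEt : ∀ t : ℤ, Pairwise fun i j =>
      Disjoint (S.charDil t '' S.coset (s i) M (α i)) (S.charDil t '' S.coset (s j) M (α j)))
    (t : Fin q → ℕ)
    (htd : Pairwise fun i j => Disjoint (S.charDil (t i) '' S.coset (s i) M (α i))
      (S.charDil (t j) '' S.coset (s j) M (α j)))
    (ht : ⋃ j, S.charDil (t j) '' S.coset (s j) M (α j) = S.ann (M + 1) \ S.ann M) :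
    ∃ hψ : ∀ i : Fin q × ℤ × S.H₀,
        MemLp (S.affine (S.wavelet μ ν φ (m i.1)) i.2.1 (i.2.2 : G)) 2 μ,
      IsParsevalFrame (fun i => (hψ i).toLp) := by
  simp only [S.coset_eq_smul_ann] at hm htd ht
  exact theorem3p1_general S μ hμ ν hν _ s (fun j => t j) M htd ht _ fun j =>
    congrArg (invFourierTr ν) (funext (hm j))
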